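/- Let $\Bbbk$ be a field of characteristic zero, let $t,a,b,p\in\Bbbk$ with $t\neq 0$, and let $V$ be the vector space with basis $x_1,x_2,x_3$ and braiding $c=c_{t,a,b,p}$ of type $\mathfrak{R}_{1,1}$: \begin{align*} c(x_1\otimes x_1)&=t\,x_1\otimes x_1,\quad c(x_2\otimes x_1)=t\,x_1\otimes x_2,\quad c(x_3\otimes x_1)=t\,x_1\otimes x_3+ta\,x_1\otimes x_1,\\ c(x_1\otimes x_2)&=t\,x_2\otimes x_1,\quad c(x_2\otimes x_2)=t\,x_2\otimes x_2,\\ c(x_3\otimes x_2)&=t\,x_2\otimes x_3+ta\,x_2\otimes x_1+t(a-b)\,x_1\otimes x_2,\\ c(x_1\otimes x_3)&=t\,x_3\otimes x_1-ta\,x_1\otimes x_1,\\ c(x_2\otimes x_3)&=t\,x_3\otimes x_2+t(b-a)\,x_2\otimes x_1-ta\,x_1\otimes x_2,\\ c(x_3\otimes x_3)&=t\,x_3\otimes x_3+tb\,x_3\otimes x_1-tp\,x_2\otimes x_1-tb\,x_1\otimes x_3+tp\,x_1\otimes x_2-tab\,x_1\otimes x_1. \end{align*} Let $\mathfrak{B}(V)=T(V)/\mathcal{J}(V)$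 be its Nichols algebra, where $\mathcal{J}(V)$ is the largest homogeneous Hopf ideal of the braided Hopf algebra $T(V)$ (the elements of $V$ being primitive) generated by homogeneous elements of degree at least $2$. 1. If $t^2\neq 1$, there are no quadratic relations: $\mathcal{J}(V)\cap T^2(V)=0$. 2. If $t=-1$, then $$\mathcal{J}(V)=\langle x_2x_1+x_1x_2,\ x_3x_1+x_1x_3,\ x_3x_2+x_2x_3-b\,x_1x_2,\ x_1^2,\ x_2^2,\ x_3^2-b\,x_1x_3+p\,x_1x_2\rangle,$$ the monomials $x_1^{a_1}x_2^{a_2}x_3^{a_3}$ with $a_i\in\{0,1\}$ form a basis of $\mathfrak{B}(V)$, $\dim\mathfrak{B}(V)=8$ and $\operatorname{GKdim}\mathfrak{B}(V)=0$. 3. If $t=1$, then $$\mathcal{J}(V)=\langle x_2x_1-x_1x_2,\ x_3x_1-x_1x_3-a\,x_1^2,\ x_3x_2-x_2x_3+(b-2a)\,x_1x_2\rangle,$$ the monomials $x_1^{a_1}x_2^{a_2}x_3^{a_3}$ with $a_i\geq 0$ form a (PBW) basis of $\mathfrak{B}(V)$, and $\operatorname{GKdim}\mathfrak{B}(V)=3$.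 -/

import Mathlib

open scoped TensorProduct

noncomputable section

namespace BraidedNichols

section General

variable {k : Type*} [Field k] {ι : Type*} [Fintype ι] [DecidableEq ι]

/-!
Let `V` be the vector space with basis `x_i`, `i : ι`. Its tensor algebra `T(V)` is the free
algebra `FreeAlgebra k ι`. A linear endomorphism `c` of `V ⊗ V` is encoded by its structure
constants `r`: `c (x_i ⊗ x_j) = ∑ m l, r i j m l • x_m ⊗ x_l`.
-/

/-- The homogeneous component `T^n(V)`, spanned by the words of length `n`. -/
def tensorPower (k : Type*) [Field k] (ι : Type*) (n : ℕ) : Submodule k (FreeAlgebra k ι) :=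
  Submodule.span k (Set.range (FreeAlgebra.ι k)) ^ n

/-- The extension of `c` to a map `V ⊗ T(V) → T(V) ⊗ V`, in matrix form:
`c (x_i ⊗ y) = ∑ l, letterBraiding r y i l ⊗ x_l`. The compatibility
`c (id ⊗ mul) = (mul ⊗ id) (id ⊗ c) (c ⊗ id)` of the braiding of `T(V)` with the product says
exactly that this matrix is multiplicative in `y`. -/
def letterBraiding (r : ι → ι → ι → ι → k) :
    FreeAlgebra k ι →ₐ[k] Matrix ι ι (FreeAlgebra k ι) :=
  FreeAlgebra.lift k fun j =>
    Matrix.of fun i l => ∑ m, r i j m l • FreeAlgebra.ι k m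

/-- Left multiplication by `1 ⊗ x_i` in the braided tensor product algebra `T(V) ⊗ T(V)`, whose
product is `(a ⊗ b) (a' ⊗ b') = a c(b ⊗ a') b'`. So
`y ⊗ z ↦ c (x_i ⊗ y) (1 ⊗ z) = ∑ l, letterBraiding r y i l ⊗ x_l z`. -/
def mulRightLetter (r : ι → ι → ι → ι → k) (i : ι) :
    Module.End k (FreeAlgebra k ι ⊗[k] FreeAlgebra k ι) :=
  ∑ l, TensorProduct.map
    (Matrix.entryLinearMap k (FreeAlgebra k ι) i l ∘ₗ (letterBraiding r).toLinearMap)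
    (LinearMap.mulLeft k (FreeAlgebra.ι k l))

/-- Left multiplication by `x_i ⊗ 1` in the braided tensor product algebra `T(V) ⊗ T(V)`. -/
def mulLeftLetter (i : ι) : Module.End k (FreeAlgebra k ι ⊗[k] FreeAlgebra k ι) :=
  TensorProduct.map (LinearMap.mulLeft k (FreeAlgebra.ι k i)) LinearMap.id

/-- The comultiplication of the braided Hopf algebra `T(V)`: the algebra map from `T(V)` to the
braided tensor product algebra `T(V) ⊗ T(V)` with `x_i ↦ x_i ⊗ 1 + 1 ⊗ x_i`. It is obtained by
letting `x_i` act by left multiplication by `x_i ⊗ 1 + 1 ⊗ x_i`, and applying the operator of an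
element of `T(V)` to the unit `1 ⊗ 1`. -/
def comul (r : ι → ι → ι → ι → k) :
    FreeAlgebra k ι →ₗ[k] FreeAlgebra k ι ⊗[k] FreeAlgebra k ι :=
  LinearMap.applyₗ (1 ⊗ₜ[k] 1) ∘ₗ
    (FreeAlgebra.lift k fun i => mulLeftLetter i + mulRightLetter r i).toLinearMap

/-- A two-sided ideal `I` of `T(V)` is a homogeneous Hopf ideal generated in degrees at least two
if it is generated by homogeneous elements of degree at least two and
`Δ(I) ⊆ I ⊗ T(V) + T(V) ⊗ I`. (The counit vanishes on such an ideal, since its elements have no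
component of degree `0`. Stability under the antipode is automatic, since `T(V)/I` is a connected
graded braided bialgebra.) -/
structure IsHopfIdeal (r : ι → ι → ι → ι → k) (I : TwoSidedIdeal (FreeAlgebra k ι)) : Prop where
  generated : I = TwoSidedIdeal.span {x | x ∈ I ∧ ∃ n, 2 ≤ n ∧ x ∈ tensorPower k ι n}
  coideal : ∀ x ∈ I, comul r x ∈ Submodule.span k
    {z : FreeAlgebra k ι ⊗[k] FreeAlgebra k ι | ∃ u v, (u ∈ I ∨ v ∈ I) ∧ z = u ⊗ₜ[k] v}

/-- The defining ideal `J(V)` of the Nichols algebra: the largest homogeneous Hopf ideal of `T(V)`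
generated in degrees at least two, that is, the sum of all of them. -/
def nicholsIdeal (r : ι → ι → ι → ι → k) : TwoSidedIdeal (FreeAlgebra k ι) :=
  sSup {I | IsHopfIdeal r I}

/-- The Nichols algebra `B(V) = T(V) / J(V)`. -/
abbrev NicholsAlgebra (r : ι → ι → ι → ι → k) : Type _ := (nicholsIdeal r).ringCon.Quotient

/-- The image of the basis vector `x_i` in the Nichols algebra. -/
def NicholsAlgebra.gen (r : ι → ι → ι → ι → k) (i : ι) : NicholsAlgebra r :=
  (nicholsIdeal r).ringCon.mk' (FreeAlgebra.ι k i)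

end General

/-- The Gelfand-Kirillov dimension of a `k`-algebra `A`: the supremum, over the finite-dimensional
subspaces `W` of `A` containing `1`, of `limsup (log (dim W ^ n) / log n)`. -/
def gkDim (k : Type*) [Field k] (A : Type*) [Ring A] [Algebra k A] : EReal :=
  ⨆ W : {W : Submodule k A // FiniteDimensional k W ∧ (1 : A) ∈ W},
    Filter.limsup
      (fun n : ℕ => ((Real.log (Module.finrank k ↥(W.1 ^ n)) / Real.log n : ℝ) : EReal))
      Filter.atTop

/-- The braiding `c` of type `R_{1,1}` on the space with basis `x_1, x_2, x_3` (indexed by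
`0, 1, 2`). The matrix in row `i`, column `j` has as its entry `(m, l)` the coefficient of
`x_m ⊗ x_l` in `c (x_i ⊗ x_j)`. -/
def braidingR11 {k : Type*} [Field k] (t a b p : k) : Fin 3 → Fin 3 → Fin 3 → Fin 3 → k :=
  ![![!![t, 0, 0;
         0, 0, 0;
         0, 0, 0],
      !![0, 0, 0;
         t, 0, 0;
         0, 0, 0],
      !![-(t * a), 0, 0;
         0, 0, 0;
         t, 0, 0]],
    ![!![0, t, 0;
         0, 0, 0;
         0, 0, 0],
      !![0, 0, 0;
         0, t, 0;
         0, 0, 0],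
      !![0, -(t * a), 0;
         t * (b - a), 0, 0;
         0, t, 0]],
    ![!![t * a, 0, t;
         0, 0, 0;
         0, 0, 0],
      !![0, t * (a - b), 0;
         t * a, 0, t;
         0, 0, 0],
      !![-(t * a * b), t * p, -(t * b);
         -(t * p), 0, 0;
         t * b, 0, t]]]

section Relations

variable {k : Type*} [Field k]

/-- The generators `x_1, x_2, x_3` of `T(V)`, indexed by `0, 1, 2`. -/
abbrev X (i : Fin 3) : FreeAlgebra k (Fin 3) := FreeAlgebra.ι k i

/-- The quadratic relations for `t = -1`. -/
def relationsMinusOne (b p : k) : Set (FreeAlgebra k (Fin 3)) :=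
  {X 1 * X 0 + X 0 * X 1,
   X 2 * X 0 + X 0 * X 2,
   X 2 * X 1 + X 1 * X 2 - b • (X 0 * X 1),
   X 0 ^ 2,
   X 1 ^ 2,
   X 2 ^ 2 - b • (X 0 * X 2) + p • (X 0 * X 1)}

/-- The quadratic relations for `t = 1`. -/
def relationsOne (a b : k) : Set (FreeAlgebra k (Fin 3)) :=
  {X 1 * X 0 - X 0 * X 1,
   X 2 * X 0 - X 0 * X 2 - a • X 0 ^ 2,
   X 2 * X 1 - X 1 * X 2 + (b - 2 * a) • (X 0 * X 1)}

/-- The image of the ordered monomial `x_1^{e_1} x_2^{e_2} x_3^{e_3}` in the Nichols algebra. -/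
def orderedMonomial (r : Fin 3 → Fin 3 → Fin 3 → Fin 3 → k) (e : Fin 3 → ℕ) :
    NicholsAlgebra r :=
  NicholsAlgebra.gen r 0 ^ e 0 * NicholsAlgebra.gen r 1 ^ e 1 * NicholsAlgebra.gen r 2 ^ e 2

end Relations

end BraidedNichols

end

/-! Write `L(y)` for the matrix `letterBraiding r y`, which describes `c(x_i ⊗ y)`. The Nichols
algebra is bounded from below by skew derivations and from above by exhibiting an explicit Hopf
ideal; ordered monomials make the two bounds meet.

Lower bound. The skew derivations `∂_l` satisfy `∂_l(x_i y) = x_i ∂_l(y) + L(y)_{il}`. They preserve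
every Hopf ideal generated in degrees at least two, hence also `J(V)`, and the counit vanishes on
`J(V)`. For the braiding of type `R_{1,1}` the matrix `L(y)` is lower triangular, so `∂_l` commutes
with left multiplication by `x_i` for `i < l`. Therefore the functionals `ε ∂_1^{e_1} ∂_2^{e_2}
∂_3^{e_3}` are triangular on ordered monomials, with products of `t`-factorials on the diagonal.
These are nonzero for all exponents if `t = 1` in characteristic zero, and for exponents at most one
if `t = -1`. So `linearIndependent_orderedMonomial` gives independence in `B(V)`.

Upper bound. Let `A` be the algebra presented by the quadratic relations. Straightening shows that
ordered monomials span `A`. If the relations generate a Hopf ideal, then `A` maps onto `B(V)`, and a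
spanning family of `A` has independent image, so the map is injective (`nicholsIdeal_eq_span`). For
the Hopf property (`isHopfIdeal_R11`), the braiding descends to `A` because the matrices `L(x_j)`
over `A` satisfy the relations. The coproduct modulo the ideal is then given by `x_i ↦ x_i ⊗ 1 + ∑
L_{il} ⊗ x_l` in `End A ⊗ A`, and these elements must satisfy the relations too. This is a finite
computation once the operators `L_{il}` are known to obey `CommutationRelations`, which follow by
induction from the way they pass the letters.

In degree two, `ε ∂_m ∂_l` reads off the coordinates of `1 + c`, which is injective when `t² ≠ 1`.
The dimension and the Gelfand-Kirillov dimension come from counting ordered monomials. -/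

namespace BraidedNichols

/-! ### Homogeneous components, counit and linear part of the tensor algebra -/

section General

variable {k : Type*} [Field k] {ι : Type*}

/-- Induction on the free algebra by left multiplication with letters. -/
theorem freeAlgebra_induction_left {P : FreeAlgebra k ι → Prop} (one : P 1)
    (add : ∀ x y, P x → P y → P (x + y)) (smul : ∀ (s : k) x, P x → P (s • x))
    (mul : ∀ i x, P x → P (FreeAlgebra.ι k i * x)) (y : FreeAlgebra k ι) : P y := by
  have key : ∀ z y : FreeAlgebra k ι, P y → P (z * y) := by
    intro z
    induction z with
    | grade0 s => intro y hy; rw [← Algebra.smul_def]; exact smul _ _ hy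
    | grade1 i => intro y hy; exact mul _ _ hy
    | mul u v hu hv => intro y hy; rw [mul_assoc]; exact hu _ (hv _ hy)
    | add u v hu hv => intro y hy; rw [add_mul]; exact add _ _ (hu _ hy) (hv _ hy)
  simpa using key y 1 one

theorem tensorPower_zero : tensorPower k ι 0 = 1 := pow_zero _

theorem tensorPower_one : tensorPower k ι 1 = Submodule.span k (Set.range (FreeAlgebra.ι k)) :=
  pow_one _

theorem ι_mem_tensorPower_one (i : ι) : FreeAlgebra.ι k i ∈ tensorPower k ι 1 := by
  rw [tensorPower_one]; exact Submodule.subset_span ⟨i, rfl⟩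

theorem mul_mem_tensorPower {m n : ℕ} {x y : FreeAlgebra k ι} (hx : x ∈ tensorPower k ι m)
    (hy : y ∈ tensorPower k ι n) : x * y ∈ tensorPower k ι (m + n) := by
  rw [tensorPower, pow_add]; exact Submodule.mul_mem_mul hx hy

/-- Induction on homogeneous elements by left multiplication with letters. -/
theorem tensorPower_succ_induction {n : ℕ}
    {P : ∀ x : FreeAlgebra k ι, x ∈ tensorPower k ι (n + 1) → Prop} (zero : P 0 (zero_mem _))
    (add : ∀ x y hx hy, P x hx → P y hy → P (x + y) (add_mem hx hy))
    (smul : ∀ (s : k) x hx, P x hx → P (s • x) (Submodule.smul_mem _ s hx))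
    (mul : ∀ i x, x ∈ tensorPower k ι n → ∀ h, P (FreeAlgebra.ι k i * x) h)
    {y : FreeAlgebra k ι} (hy : y ∈ tensorPower k ι (n + 1)) : P y hy := by
  suffices h : ∃ h, P y h from h.2
  rw [tensorPower, pow_succ'] at hy
  refine Submodule.mul_induction_on hy ?_ fun x y ⟨_, hx⟩ ⟨_, hy⟩ => ⟨_, add _ _ _ _ hx hy⟩
  intro u hu v hv
  induction hu using Submodule.span_induction with
  | mem x h =>
    obtain ⟨i, rfl⟩ := h
    refine ⟨?_, mul i v hv _⟩
    rw [add_comm n 1]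
    exact mul_mem_tensorPower (ι_mem_tensorPower_one i) hv
  | zero => rw [zero_mul]; exact ⟨_, zero⟩
  | add x y _ _ hx hy =>
    obtain ⟨_, hx⟩ := hx
    obtain ⟨_, hy⟩ := hy
    rw [add_mul]; exact ⟨_, add _ _ _ _ hx hy⟩
  | smul s x _ hx =>
    obtain ⟨_, hx⟩ := hx
    rw [smul_mul_assoc]; exact ⟨_, smul _ _ _ hx⟩

theorem algebraMapInv_ι_mul (i : ι) (y : FreeAlgebra k ι) :
    FreeAlgebra.algebraMapInv (FreeAlgebra.ι k i * y) = (0 : k) := by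
  simp [FreeAlgebra.algebraMapInv]

theorem algebraMapInv_eq_zero_of_mem_tensorPower {n : ℕ} {x : FreeAlgebra k ι}
    (hx : x ∈ tensorPower k ι (n + 1)) : FreeAlgebra.algebraMapInv x = (0 : k) := by
  induction hx using tensorPower_succ_induction with
  | zero => simp
  | add x y _ _ hx hy => rw [map_add, hx, hy, add_zero]
  | smul s x _ hx => rw [map_smul, hx, smul_zero]
  | mul i x _ _ => exact algebraMapInv_ι_mul i x

/-- The map `y ⊗ z ↦ ε(z) y`. -/
def rightCounit : FreeAlgebra k ι ⊗[k] FreeAlgebra k ι →ₗ[k] FreeAlgebra k ι :=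
  (TensorProduct.rid k _).toLinearMap ∘ₗ
    TensorProduct.map LinearMap.id FreeAlgebra.algebraMapInv.toLinearMap

theorem rightCounit_tmul (y z : FreeAlgebra k ι) :
    rightCounit (y ⊗ₜ[k] z) = (FreeAlgebra.algebraMapInv z : k) • y := by
  simp [rightCounit]

theorem rightCounit_mulLeftLetter (i : ι) (z : FreeAlgebra k ι ⊗[k] FreeAlgebra k ι) :
    rightCounit (mulLeftLetter i z) = FreeAlgebra.ι k i * rightCounit z := by
  induction z using TensorProduct.induction_on with
  | zero => simp
  | tmul u v => simp [mulLeftLetter, rightCounit_tmul]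
  | add u v hu hv => simp only [map_add, mul_add, hu, hv]

variable [DecidableEq ι]

/-- The algebra map to the dual numbers which sends `x_l` to `ε` and the other letters to `0`. -/
def letterDual (l : ι) : FreeAlgebra k ι →ₐ[k] DualNumber k :=
  FreeAlgebra.lift k fun i => if i = l then DualNumber.eps else 0

/-- The coefficient of the letter `x_l` in an element of the free algebra. -/
def letterCoeff (l : ι) : FreeAlgebra k ι →ₗ[k] k :=
  TrivSqZeroExt.sndHom k k ∘ₗ (letterDual l).toLinearMap

theorem letterDual_ι (l i : ι) :
    letterDual l (FreeAlgebra.ι k i) = if i = l then DualNumber.eps else 0 := by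
  simp [letterDual]

theorem fst_letterDual (l : ι) (y : FreeAlgebra k ι) :
    (letterDual l y).fst = FreeAlgebra.algebraMapInv y := by
  have : (TrivSqZeroExt.fstHom k k k).comp (letterDual l) =
      (FreeAlgebra.algebraMapInv : FreeAlgebra k ι →ₐ[k] k) := by
    ext i
    by_cases h : i = l <;> simp [letterDual_ι, FreeAlgebra.algebraMapInv, h]
  exact DFunLike.congr_fun this y

theorem letterCoeff_one (l : ι) : letterCoeff l (1 : FreeAlgebra k ι) = 0 := by
  simp [letterCoeff]

theorem letterCoeff_ι_mul (l i : ι) (y : FreeAlgebra k ι) :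
    letterCoeff l (FreeAlgebra.ι k i * y) =
      if i = l then FreeAlgebra.algebraMapInv y else 0 := by
  by_cases h : i = l <;> simp [letterCoeff, letterDual_ι, h, fst_letterDual]

theorem letterDual_eq_zero_of_mem_tensorPower (l : ι) {n : ℕ} (hn : 2 ≤ n) {x : FreeAlgebra k ι}
    (hx : x ∈ tensorPower k ι n) : letterDual l x = 0 := by
  obtain ⟨m, rfl⟩ := Nat.exists_eq_add_of_le' hn
  induction hx using tensorPower_succ_induction with
  | zero => simp
  | add x y _ _ hx hy => rw [map_add, hx, hy, add_zero]
  | smul s x _ hx => rw [map_smul, hx, smul_zero]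
  | mul i x hx _ =>
    have h : (letterDual l x).fst = 0 := by
      rw [fst_letterDual]; exact algebraMapInv_eq_zero_of_mem_tensorPower hx
    rw [map_mul, letterDual_ι]
    split_ifs
    · ext <;> simp [h]
    · simp

theorem smul_mem_twoSidedIdeal {A : Type*} [Ring A] [Algebra k A] (I : TwoSidedIdeal A) (s : k)
    {x : A} (hx : x ∈ I) : s • x ∈ I := by
  rw [Algebra.smul_def]; exact I.mul_mem_left _ _ hx

/-- The map `y ⊗ z ↦ z_l y`, where `z_l` is the coefficient of `x_l` in `z`. -/
def rightLetterCoeff (l : ι) : FreeAlgebra k ι ⊗[k] FreeAlgebra k ι →ₗ[k] FreeAlgebra k ι :=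
  (TensorProduct.rid k _).toLinearMap ∘ₗ TensorProduct.map LinearMap.id (letterCoeff l)

theorem rightLetterCoeff_tmul (l : ι) (y z : FreeAlgebra k ι) :
    rightLetterCoeff l (y ⊗ₜ[k] z) = letterCoeff l z • y := by
  simp [rightLetterCoeff]

theorem rightLetterCoeff_mulLeftLetter (l i : ι) (z : FreeAlgebra k ι ⊗[k] FreeAlgebra k ι) :
    rightLetterCoeff l (mulLeftLetter i z) = FreeAlgebra.ι k i * rightLetterCoeff l z := by
  induction z using TensorProduct.induction_on with
  | zero => simp
  | tmul u v => simp [mulLeftLetter, rightLetterCoeff_tmul]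
  | add u v hu hv => simp only [map_add, mul_add, hu, hv]

/-! ### Skew derivations of the tensor algebra -/

variable [Fintype ι] (r : ι → ι → ι → ι → k)

theorem comul_one : comul r 1 = 1 ⊗ₜ[k] 1 := by simp [comul]

theorem comul_ι_mul (i : ι) (y : FreeAlgebra k ι) :
    comul r (FreeAlgebra.ι k i * y) = mulLeftLetter i (comul r y) +
      mulRightLetter r i (comul r y) := by
  simp [comul]

theorem rightCounit_mulRightLetter (i : ι) (z : FreeAlgebra k ι ⊗[k] FreeAlgebra k ι) :
    rightCounit (mulRightLetter r i z) = 0 := by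
  induction z using TensorProduct.induction_on with
  | zero => simp
  | tmul u v => simp [mulRightLetter, LinearMap.sum_apply, rightCounit_tmul,
      FreeAlgebra.algebraMapInv]
  | add u v hu hv => simp only [map_add, hu, hv, add_zero]

/-- The right counit law of the comultiplication. -/
theorem rightCounit_comul (y : FreeAlgebra k ι) : rightCounit (comul r y) = y := by
  induction y using freeAlgebra_induction_left with
  | one => simp [comul_one, rightCounit_tmul]
  | add x y hx hy => rw [map_add, map_add, hx, hy]
  | smul s x hx => rw [map_smul, map_smul, hx]
  | mul i x hx =>
    rw [comul_ι_mul, map_add, rightCounit_mulLeftLetter, rightCounit_mulRightLetter, hx, add_zero]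

theorem rightLetterCoeff_mulRightLetter (l i : ι) (z : FreeAlgebra k ι ⊗[k] FreeAlgebra k ι) :
    rightLetterCoeff l (mulRightLetter r i z) = letterBraiding r (rightCounit z) i l := by
  induction z using TensorProduct.induction_on with
  | zero => simp
  | tmul u v =>
    simp [mulRightLetter, LinearMap.sum_apply, rightLetterCoeff_tmul, rightCounit_tmul,
      letterCoeff_ι_mul]
  | add u v hu hv => simp only [map_add, hu, hv, Matrix.add_apply]

/-- The skew derivation `∂_l` of `T(V)`, given by `Δ(y) = y ⊗ 1 + ∑ l, ∂_l y ⊗ x_l + ⋯`. -/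
def skewDeriv (l : ι) : FreeAlgebra k ι →ₗ[k] FreeAlgebra k ι :=
  rightLetterCoeff l ∘ₗ comul r

theorem skewDeriv_one (l : ι) : skewDeriv r l 1 = 0 := by
  simp [skewDeriv, comul_one, rightLetterCoeff_tmul, letterCoeff_one]

/-- In `(1 ⊗ x_i) Δ(y)` a single letter can remain in the right factor only from the component `y ⊗
1` of `Δ(y)`, which the counit law identifies; it contributes the entry of the braiding matrix. -/
theorem skewDeriv_ι_mul (l i : ι) (y : FreeAlgebra k ι) :
    skewDeriv r l (FreeAlgebra.ι k i * y) =
      FreeAlgebra.ι k i * skewDeriv r l y + letterBraiding r y i l := by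
  simp [skewDeriv, comul_ι_mul, rightLetterCoeff_mulLeftLetter, rightLetterCoeff_mulRightLetter,
    rightCounit_comul]

theorem skewDeriv_ι (l i : ι) :
    skewDeriv r l (FreeAlgebra.ι k i) = if i = l then 1 else 0 := by
  have := skewDeriv_ι_mul r l i 1
  rw [mul_one, skewDeriv_one, mul_zero, zero_add, map_one] at this
  rw [this, Matrix.one_apply]

theorem letterBraiding_ι (i j l : ι) : letterBraiding r (FreeAlgebra.ι k j) i l =
    ∑ m, r i j m l • FreeAlgebra.ι k m := by
  simp [letterBraiding]

theorem letterBraiding_mem_tensorPower {n : ℕ} {y : FreeAlgebra k ι}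
    (hy : y ∈ tensorPower k ι n) (i l : ι) : letterBraiding r y i l ∈ tensorPower k ι n := by
  induction n generalizing y i l with
  | zero =>
    rw [tensorPower_zero] at hy ⊢
    obtain ⟨s, rfl⟩ := Submodule.mem_one.mp hy
    rw [Submodule.mem_one, AlgHom.commutes, Matrix.algebraMap_matrix_apply]
    split_ifs
    · exact ⟨s, rfl⟩
    · exact ⟨0, map_zero _⟩
  | succ n ih =>
    induction hy using tensorPower_succ_induction generalizing i l with
    | zero => simp
    | add x y _ _ hx hy => rw [map_add]; exact add_mem (hx _ _) (hy _ _)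
    | smul s x _ hx => rw [map_smul]; exact Submodule.smul_mem _ _ (hx _ _)
    | mul j x hx _ =>
      rw [map_mul, Matrix.mul_apply, add_comm n 1]
      refine Submodule.sum_mem _ fun m _ => mul_mem_tensorPower ?_ (ih hx _ _)
      rw [letterBraiding_ι]
      exact Submodule.sum_mem _ fun m _ => Submodule.smul_mem _ _ (ι_mem_tensorPower_one m)

theorem skewDeriv_eq_zero_of_mem_tensorPower_zero (l : ι) {y : FreeAlgebra k ι}
    (hy : y ∈ tensorPower k ι 0) : skewDeriv r l y = 0 := by
  rw [tensorPower_zero] at hy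
  obtain ⟨s, rfl⟩ := Submodule.mem_one.mp hy
  rw [Algebra.algebraMap_eq_smul_one, map_smul, skewDeriv_one, smul_zero]

theorem skewDeriv_mem_tensorPower (l : ι) {n : ℕ} {y : FreeAlgebra k ι}
    (hy : y ∈ tensorPower k ι (n + 1)) : skewDeriv r l y ∈ tensorPower k ι n := by
  induction n generalizing y with
  | zero =>
    induction hy using tensorPower_succ_induction with
    | zero => simp
    | add x y _ _ hx hy => rw [map_add]; exact add_mem hx hy
    | smul s x _ hx => rw [map_smul]; exact Submodule.smul_mem _ _ hx
    | mul i x hx _ =>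
      rw [skewDeriv_ι_mul, skewDeriv_eq_zero_of_mem_tensorPower_zero r l hx, mul_zero, zero_add]
      exact letterBraiding_mem_tensorPower r hx _ _
  | succ n ih =>
    induction hy using tensorPower_succ_induction with
    | zero => simp
    | add x y _ _ hx hy => rw [map_add]; exact add_mem hx hy
    | smul s x _ hx => rw [map_smul]; exact Submodule.smul_mem _ _ hx
    | mul i x hx _ =>
      rw [skewDeriv_ι_mul]
      refine add_mem ?_ (letterBraiding_mem_tensorPower r hx _ _)
      rw [add_comm n 1]
      exact mul_mem_tensorPower (ι_mem_tensorPower_one i) (ih hx)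

/-! ### Stability of Hopf ideals and of the Nichols ideal under skew derivations -/

variable {r} {I : TwoSidedIdeal (FreeAlgebra k ι)}

/-- The letter coefficient is not multiplicative, but it is a component of an algebra map to the
dual numbers, whose kernel is an ideal and so need only contain the generators. -/
theorem IsHopfIdeal.letterCoeff_eq_zero (hI : IsHopfIdeal r I) (l : ι) {x : FreeAlgebra k ι}
    (hx : x ∈ I) : letterCoeff l x = 0 := by
  have h : I ≤ TwoSidedIdeal.ker (letterDual (k := k) l) := by
    rw [hI.generated, TwoSidedIdeal.span_le]
    rintro y ⟨-, n, hn, hy⟩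
    exact (TwoSidedIdeal.mem_ker _).mpr (letterDual_eq_zero_of_mem_tensorPower l hn hy)
  simp [letterCoeff, (TwoSidedIdeal.mem_ker _).mp (h hx)]

theorem IsHopfIdeal.algebraMapInv_eq_zero (hI : IsHopfIdeal r I) {x : FreeAlgebra k ι}
    (hx : x ∈ I) : FreeAlgebra.algebraMapInv x = (0 : k) := by
  have h : I ≤ TwoSidedIdeal.ker (FreeAlgebra.algebraMapInv : FreeAlgebra k ι →ₐ[k] k) := by
    rw [hI.generated, TwoSidedIdeal.span_le]
    rintro y ⟨-, n, hn, hy⟩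
    obtain ⟨m, rfl⟩ := Nat.exists_eq_add_of_le' hn
    exact (TwoSidedIdeal.mem_ker _).mpr (algebraMapInv_eq_zero_of_mem_tensorPower hy)
  exact (TwoSidedIdeal.mem_ker _).mp (h hx)

/-- On `u ⊗ v` the coefficient map gives a multiple of `u`, which is in `I` if `u` is, and is zero
if `v ∈ I`, since `I` has no linear part. -/
theorem IsHopfIdeal.skewDeriv_mem (hI : IsHopfIdeal r I) (l : ι) {x : FreeAlgebra k ι}
    (hx : x ∈ I) : skewDeriv r l x ∈ I := by
  have key : ∀ z ∈ Submodule.span k {z : FreeAlgebra k ι ⊗[k] FreeAlgebra k ι |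
      ∃ u v, (u ∈ I ∨ v ∈ I) ∧ z = u ⊗ₜ[k] v}, rightLetterCoeff l z ∈ I := by
    intro z hz
    induction hz using Submodule.span_induction with
    | mem z h =>
      obtain ⟨u, v, h, rfl⟩ := h
      rw [rightLetterCoeff_tmul]
      rcases h with h | h
      · exact smul_mem_twoSidedIdeal I _ h
      · rw [hI.letterCoeff_eq_zero l h, zero_smul]; exact I.zero_mem
    | zero => rw [map_zero]; exact I.zero_mem
    | add x y _ _ hx hy => rw [map_add]; exact I.add_mem hx hy
    | smul s x _ hx => rw [map_smul]; exact smul_mem_twoSidedIdeal I _ hx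
  exact key _ (hI.coideal x hx)

theorem IsHopfIdeal.le_nicholsIdeal (hI : IsHopfIdeal r I) : I ≤ nicholsIdeal r :=
  le_sSup hI

/-- Elements of the Nichols ideal are sums of elements of Hopf ideals. -/
theorem nicholsIdeal_induction {P : ∀ x, x ∈ nicholsIdeal r → Prop}
    (zero : P 0 (nicholsIdeal r).zero_mem)
    (add : ∀ x y hx hy, P x hx → P y hy → P (x + y) ((nicholsIdeal r).add_mem hx hy))
    (mem : ∀ I (hI : IsHopfIdeal r I) x (hx : x ∈ I), P x (hI.le_nicholsIdeal hx))
    {x : FreeAlgebra k ι} (hx : x ∈ nicholsIdeal r) : P x hx := by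
  -- The additive subgroup generated by the union of all Hopf ideals is already a two-sided ideal,
  -- so it contains the supremum.
  let U : Set (FreeAlgebra k ι) := {x | ∃ I, IsHopfIdeal r I ∧ x ∈ I}
  have left : ∀ x, ∀ y ∈ AddSubgroup.closure U, x * y ∈ AddSubgroup.closure U := by
    intro x y hy
    induction hy using AddSubgroup.closure_induction with
    | mem y h =>
      obtain ⟨I, hI, hy⟩ := h
      exact AddSubgroup.subset_closure ⟨I, hI, I.mul_mem_left _ _ hy⟩
    | zero => rw [mul_zero]; exact zero_mem _
    | add a b _ _ ha hb => rw [mul_add]; exact add_mem ha hb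
    | neg a _ ha => rw [mul_neg]; exact neg_mem ha
  have right : ∀ y ∈ AddSubgroup.closure U, ∀ x, y * x ∈ AddSubgroup.closure U := by
    intro y hy x
    induction hy using AddSubgroup.closure_induction with
    | mem y h =>
      obtain ⟨I, hI, hy⟩ := h
      exact AddSubgroup.subset_closure ⟨I, hI, I.mul_mem_right _ _ hy⟩
    | zero => rw [zero_mul]; exact zero_mem _
    | add a b _ _ ha hb => rw [add_mul]; exact add_mem ha hb
    | neg a _ ha => rw [neg_mul]; exact neg_mem ha
  let N : TwoSidedIdeal (FreeAlgebra k ι) := TwoSidedIdeal.mk' (AddSubgroup.closure U : Set _)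
    (zero_mem _) (fun ha hb => add_mem ha hb) (fun ha => neg_mem ha)
    (fun {a b} hb => left a b hb) (fun {a b} ha => right a ha b)
  have hN : nicholsIdeal r ≤ N := by
    refine sSup_le fun I hI y hy => ?_
    rw [TwoSidedIdeal.mem_mk']
    exact AddSubgroup.subset_closure ⟨I, hI, hy⟩
  have hx' : x ∈ AddSubgroup.closure U := by
    have := hN hx
    rwa [TwoSidedIdeal.mem_mk'] at this
  -- `P` is not assumed stable under negation, so it is carried along for `x` and `-x` together.
  have hP : (∃ h, P x h) ∧ ∃ h, P (-x) h := by
    clear hx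
    induction hx' using AddSubgroup.closure_induction with
    | mem y h =>
      obtain ⟨I, hI, hy⟩ := h
      exact ⟨⟨_, mem I hI y hy⟩, _, mem I hI _ (I.neg_mem hy)⟩
    | zero => exact ⟨⟨_, zero⟩, by rw [neg_zero]; exact ⟨_, zero⟩⟩
    | add a b _ _ ha hb =>
      obtain ⟨⟨_, ha⟩, _, ha'⟩ := ha
      obtain ⟨⟨_, hb⟩, _, hb'⟩ := hb
      exact ⟨⟨_, add _ _ _ _ ha hb⟩, by rw [neg_add]; exact ⟨_, add _ _ _ _ ha' hb'⟩⟩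
    | neg a _ ha => exact ⟨ha.2, by rw [neg_neg]; exact ha.1⟩
  exact hP.1.2

theorem skewDeriv_mem_nicholsIdeal (l : ι) {x : FreeAlgebra k ι} (hx : x ∈ nicholsIdeal r) :
    skewDeriv r l x ∈ nicholsIdeal r := by
  induction hx using nicholsIdeal_induction with
  | zero => rw [map_zero]; exact (nicholsIdeal r).zero_mem
  | add x y _ _ hx hy => rw [map_add]; exact (nicholsIdeal r).add_mem hx hy
  | mem I hI x hx => exact hI.le_nicholsIdeal (hI.skewDeriv_mem l hx)

theorem algebraMapInv_eq_zero_of_mem_nicholsIdeal {x : FreeAlgebra k ι}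
    (hx : x ∈ nicholsIdeal r) : FreeAlgebra.algebraMapInv x = (0 : k) := by
  induction hx using nicholsIdeal_induction with
  | zero => exact map_zero _
  | add x y _ _ hx hy => rw [map_add, hx, hy, add_zero]
  | mem I hI x hx => exact hI.algebraMapInv_eq_zero hx

end General

end BraidedNichols

namespace BraidedNichols

/-! ### Powers of skew derivations and `t`-factorials -/

section SkewDerivPowers

variable {k : Type*} [Field k]

/-- The `q`-number `1 + t + ⋯ + t ^ (n - 1)`. -/
def qNumber (t : k) (n : ℕ) : k := ∑ i ∈ Finset.range n, t ^ i

/-- The `q`-factorial `(1)_t (2)_t ⋯ (n)_t`. -/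
def qFactorial (t : k) (n : ℕ) : k := ∏ i ∈ Finset.range n, qNumber t (i + 1)

theorem qNumber_succ (t : k) (n : ℕ) : qNumber t (n + 1) = qNumber t n + t ^ n :=
  Finset.sum_range_succ _ _

theorem qFactorial_succ (t : k) (n : ℕ) :
    qFactorial t (n + 1) = qFactorial t n * qNumber t (n + 1) :=
  Finset.prod_range_succ _ _

theorem qFactorial_zero (t : k) : qFactorial t 0 = 1 := Finset.prod_range_zero _

theorem qFactorial_one (t : k) : qFactorial t 1 = 1 := by simp [qFactorial, qNumber]

theorem qFactorial_one_left_ne_zero [CharZero k] (n : ℕ) : qFactorial (1 : k) n ≠ 0 := by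
  refine Finset.prod_ne_zero_iff.mpr fun i _ => ?_
  simp only [qNumber, one_pow, Finset.sum_const, Finset.card_range, nsmul_eq_mul, mul_one]
  exact Nat.cast_ne_zero.mpr i.succ_ne_zero

variable {ι : Type*}

theorem ι_pow_mem_tensorPower (i : ι) (n : ℕ) : FreeAlgebra.ι k i ^ n ∈ tensorPower k ι n := by
  rw [tensorPower]
  exact Submodule.pow_mem_pow _ (Submodule.subset_span (Set.mem_range_self i)) _

variable [DecidableEq ι]

variable (k) in
/-- The character of `T(V)` which sends `x_l` to `1` and the other letters to `0`. -/
def letterCharacter (l : ι) : FreeAlgebra k ι →ₐ[k] k :=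
  FreeAlgebra.lift k fun i => if i = l then 1 else 0

theorem letterCharacter_ι (l i : ι) :
    letterCharacter k l (FreeAlgebra.ι k i) = if i = l then 1 else 0 := by
  simp [letterCharacter]

variable [Fintype ι] (r : ι → ι → ι → ι → k)

theorem skewDeriv_pow_eq_zero (l : ι) {m n : ℕ} (h : m < n) {y : FreeAlgebra k ι}
    (hy : y ∈ tensorPower k ι m) : (skewDeriv r l ^ n) y = 0 := by
  induction n generalizing m y with
  | zero => omega
  | succ n ih =>
    rw [pow_succ, Module.End.mul_apply]
    cases m with
    | zero => rw [skewDeriv_eq_zero_of_mem_tensorPower_zero r l hy, map_zero]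
    | succ m => exact ih (by omega) (skewDeriv_mem_tensorPower r l hy)

variable {r}

theorem skewDeriv_pow_ι_pow_mul {i l : ι} (h : ∀ y, letterBraiding r y i l = 0) (m n : ℕ)
    (y : FreeAlgebra k ι) : (skewDeriv r l ^ n) (FreeAlgebra.ι k i ^ m * y) =
      FreeAlgebra.ι k i ^ m * (skewDeriv r l ^ n) y := by
  have h1 : ∀ m y, skewDeriv r l (FreeAlgebra.ι k i ^ m * y) =
      FreeAlgebra.ι k i ^ m * skewDeriv r l y := by
    intro m
    induction m with
    | zero => simp
    | succ m ih =>
      intro y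
      rw [pow_succ', mul_assoc, skewDeriv_ι_mul, h, add_zero, ih, mul_assoc]
  induction n generalizing y with
  | zero => simp
  | succ n ih => rw [pow_succ, Module.End.mul_apply, Module.End.mul_apply, h1, ih]

theorem skewDeriv_ι_pow_succ {l : ι} {t : k}
    (h : ∀ n, letterBraiding r (FreeAlgebra.ι k l ^ n) l l = t ^ n • FreeAlgebra.ι k l ^ n)
    (n : ℕ) : skewDeriv r l (FreeAlgebra.ι k l ^ (n + 1)) =
      qNumber t (n + 1) • FreeAlgebra.ι k l ^ n := by
  induction n with
  | zero => simp [skewDeriv_ι, qNumber]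
  | succ n ih =>
    rw [pow_succ', skewDeriv_ι_mul, ih, h, mul_smul_comm, ← pow_succ', qNumber_succ t (n + 1),
      add_smul]

theorem skewDeriv_pow_ι_pow {l : ι} {t : k}
    (h : ∀ n, letterBraiding r (FreeAlgebra.ι k l ^ n) l l = t ^ n • FreeAlgebra.ι k l ^ n)
    (n : ℕ) : (skewDeriv r l ^ n) (FreeAlgebra.ι k l ^ n) = qFactorial t n • 1 := by
  induction n with
  | zero => simp [qFactorial_zero]
  | succ n ih =>
    rw [pow_succ, Module.End.mul_apply, skewDeriv_ι_pow_succ h, map_smul, ih, smul_smul,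
      qFactorial_succ, mul_comm]

/-- Modulo the letters other than `x_l`, an element of degree `n` is a multiple of `x_l^n`, for
which these are the usual `t`-number identities. The second needs the first, hence the joint
induction. -/
theorem letterCharacter_skewDeriv {l : ι} {t : k}
    (h0 : ∀ i, i ≠ l → ∀ y, letterBraiding r y i l = 0)
    (h1 : ∀ i, letterCharacter k l (letterBraiding r (FreeAlgebra.ι k i) l l) =
      if i = l then t else 0) {n : ℕ} {y : FreeAlgebra k ι} (hy : y ∈ tensorPower k ι n) :
    letterCharacter k l (letterBraiding r y l l) = t ^ n * letterCharacter k l y ∧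
      letterCharacter k l (skewDeriv r l y) = qNumber t n * letterCharacter k l y := by
  induction n generalizing y with
  | zero =>
    rw [skewDeriv_eq_zero_of_mem_tensorPower_zero r l hy]
    rw [tensorPower_zero] at hy
    obtain ⟨s, rfl⟩ := Submodule.mem_one.mp hy
    simp [qNumber, Matrix.algebraMap_matrix_apply]
  | succ n ih =>
    induction hy using tensorPower_succ_induction with
    | zero => simp
    | add x y _ _ hx hy =>
      simp only [map_add, Matrix.add_apply, hx.1, hx.2, hy.1, hy.2, mul_add, and_self]
    | smul s x _ hx =>
      simp only [map_smul, Matrix.smul_apply, hx.1, hx.2, mul_smul_comm, and_self]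
    | mul i x hx _ =>
      obtain ⟨ih1, ih2⟩ := ih hx
      constructor
      · rw [map_mul, Matrix.mul_apply, Finset.sum_eq_single l
          (fun m _ hm => by rw [h0 m hm, mul_zero]) (by simp), map_mul, map_mul, h1, ih1,
          letterCharacter_ι]
        split_ifs <;> ring
      · rw [skewDeriv_ι_mul, map_add, map_mul, ih2, map_mul, letterCharacter_ι]
        by_cases hi : i = l
        · subst hi
          rw [ih1, qNumber_succ, if_pos rfl]; ring
        · rw [h0 i hi, if_neg hi]; simp

/-- Here `L(x_l^n)_{ll}` need not be a multiple of `x_l^n`. The result has degree zero, so tracking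
the image under the character is enough. -/
theorem skewDeriv_pow_of_mem_tensorPower {l : ι} {t : k}
    (h0 : ∀ i, i ≠ l → ∀ y, letterBraiding r y i l = 0)
    (h1 : ∀ i, letterCharacter k l (letterBraiding r (FreeAlgebra.ι k i) l l) =
      if i = l then t else 0) {n : ℕ} {y : FreeAlgebra k ι} (hy : y ∈ tensorPower k ι n) :
    (skewDeriv r l ^ n) y = (qFactorial t n * letterCharacter k l y) • 1 := by
  induction n generalizing y with
  | zero =>
    rw [tensorPower_zero] at hy
    obtain ⟨s, rfl⟩ := Submodule.mem_one.mp hy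
    simp [qFactorial_zero, Algebra.algebraMap_eq_smul_one]
  | succ n ih =>
    rw [pow_succ, Module.End.mul_apply, ih (skewDeriv_mem_tensorPower r l hy),
      (letterCharacter_skewDeriv h0 h1 hy).2, qFactorial_succ, mul_assoc]

end SkewDerivPowers

/-! ### Linear independence from triangular functionals -/

section Triangular

/-- In a nontrivial relation take the index `e` of largest key with nonzero coefficient: `φ e` kills
all the other terms and not this one. Since `φ e` vanishes on `ker π`, it may be evaluated on lifts
to `M`. -/
theorem linearIndependent_of_triangular {k α κ M N : Type*} [Field k] [LinearOrder κ]
    [AddCommGroup M] [Module k M] [AddCommGroup N] [Module k N] (key : α → κ)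
    (hkey : Function.Injective key) (π : M →ₗ[k] N) (v : α → M) (φ : α → M →ₗ[k] k)
    (hφ : ∀ e x, π x = 0 → φ e x = 0) (h0 : ∀ e e', key e' < key e → φ e (v e') = 0)
    (h1 : ∀ e, φ e (v e) ≠ 0) : LinearIndependent k fun e => π (v e) := by
  classical
  rw [linearIndependent_iff']
  intro s c hc
  by_contra! hne
  obtain ⟨i, hi, hci⟩ := hne
  have hs : (s.filter fun e => c e ≠ 0).Nonempty := ⟨i, by simp [hi, hci]⟩
  obtain ⟨e, he, hmax⟩ := Finset.exists_max_image _ key hs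
  rw [Finset.mem_filter] at he
  have h : π (∑ i ∈ s, c i • v i) = 0 := by simpa using hc
  have := hφ e _ h
  rw [map_sum, Finset.sum_eq_single e] at this
  · rw [map_smul, smul_eq_mul, mul_eq_zero] at this
    exact this.elim he.2 (h1 e)
  · intro e' he' hne
    rw [map_smul]
    by_cases hc' : c e' = 0
    · rw [hc', zero_smul]
    · rw [h0 e e' (lt_of_le_of_ne (hmax e' (Finset.mem_filter.mpr ⟨he', hc'⟩))
        (hkey.ne hne)), smul_zero]
  · exact fun h => absurd he.1 h

end Triangular

/-! ### Independence of ordered monomials for the braiding of type `R_{1,1}` -/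

section R11

variable {k : Type*} [Field k] {t a b p : k}

/-- The matrices `letterBraiding (braidingR11 t a b p) (x_j)`, with entries in any algebra. -/
def matrixR11 {B : Type*} [Ring B] [Algebra k B] (t a b p : k) (x : Fin 3 → B) :
    Fin 3 → Matrix (Fin 3) (Fin 3) B :=
  ![!![t • x 0, 0, 0;
       0, t • x 0, 0;
       (t * a) • x 0, 0, t • x 0],
    !![t • x 1, 0, 0;
       0, t • x 1, 0;
       (t * a) • x 1, (t * (a - b)) • x 0, t • x 1],
    !![t • x 2 - (t * a) • x 0, 0, 0;
       (t * (b - a)) • x 1, t • x 2 - (t * a) • x 0, 0;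
       (t * b) • x 2 - (t * a * b) • x 0 - (t * p) • x 1, (t * p) • x 0,
         t • x 2 - (t * b) • x 0]]

theorem letterBraiding_R11_X (j : Fin 3) :
    letterBraiding (braidingR11 t a b p) (X j) = matrixR11 t a b p X j := by
  ext i l
  rw [letterBraiding_ι, Fin.sum_univ_three]
  fin_cases j <;> fin_cases i <;> fin_cases l <;>
    simp only [braidingR11, matrixR11, Matrix.of_apply, Matrix.cons_val, Fin.mk_zero, Fin.mk_one,
      Fin.reduceFinMk, zero_smul, add_zero, zero_add]
  all_goals module

/-- Lower triangular matrices whose first two diagonal entries agree are closed under products, and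
each letter has such a matrix. The equality of diagonal entries later leaves only five distinct
operators. -/
theorem letterBraiding_R11_triangular (y : FreeAlgebra k (Fin 3)) :
    letterBraiding (braidingR11 t a b p) y 0 1 = 0 ∧
    letterBraiding (braidingR11 t a b p) y 0 2 = 0 ∧
    letterBraiding (braidingR11 t a b p) y 1 2 = 0 ∧
    letterBraiding (braidingR11 t a b p) y 1 1 = letterBraiding (braidingR11 t a b p) y 0 0 := by
  induction y using freeAlgebra_induction_left with
  | one => simp
  | add x y hx hy => simp [hx, hy]
  | smul s x hx => simp [hx]
  | mul i x hx =>
    have := letterBraiding_R11_X (t := t) (a := a) (b := b) (p := p) i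
    simp only [X] at this
    rw [map_mul, this]
    fin_cases i <;> simp [Matrix.mul_apply, Fin.sum_univ_three, matrixR11, hx]

theorem letterBraiding_R11_eq_zero {i l : Fin 3} (h : i < l) (y : FreeAlgebra k (Fin 3)) :
    letterBraiding (braidingR11 t a b p) y i l = 0 := by
  obtain ⟨h1, h2, h3, -⟩ := letterBraiding_R11_triangular (t := t) (a := a) (b := b) (p := p) y
  fin_cases i <;> fin_cases l <;> first | assumption | exact absurd h (by decide)

theorem letterBraiding_R11_zero_pow (n : ℕ) :
    letterBraiding (braidingR11 t a b p) (X 0 ^ n) 0 0 = t ^ n • X 0 ^ n := by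
  induction n with
  | zero => simp
  | succ n ih =>
    rw [pow_succ', map_mul, Matrix.mul_apply, Fin.sum_univ_three, ih, letterBraiding_R11_X]
    simp [matrixR11, smul_smul, pow_succ]

theorem letterBraiding_R11_one_pow (n : ℕ) :
    letterBraiding (braidingR11 t a b p) (X 1 ^ n) 1 1 = t ^ n • X 1 ^ n := by
  induction n with
  | zero => simp
  | succ n ih =>
    rw [pow_succ', map_mul, Matrix.mul_apply, Fin.sum_univ_three, ih, letterBraiding_R11_X]
    simp [matrixR11, smul_smul, pow_succ]

variable (t a b p) in
/-- The functional `ε ∂_1^{e_1} ∂_2^{e_2} ∂_3^{e_3}`. -/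
def derivFunctional (e : Fin 3 → ℕ) : FreeAlgebra k (Fin 3) →ₗ[k] k :=
  FreeAlgebra.algebraMapInv.toLinearMap ∘ₗ
    (skewDeriv (braidingR11 t a b p) 0 ^ e 0 * skewDeriv (braidingR11 t a b p) 1 ^ e 1 *
      skewDeriv (braidingR11 t a b p) 2 ^ e 2)

theorem skewDeriv_pow_mem_nicholsIdeal {ι : Type*} [Fintype ι] [DecidableEq ι]
    {r : ι → ι → ι → ι → k} (l : ι) (n : ℕ) {x : FreeAlgebra k ι}
    (hx : x ∈ nicholsIdeal r) : (skewDeriv r l ^ n) x ∈ nicholsIdeal r := by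
  induction n generalizing x with
  | zero => simpa using hx
  | succ n ih =>
    rw [pow_succ, Module.End.mul_apply]
    exact ih (skewDeriv_mem_nicholsIdeal l hx)

theorem derivFunctional_eq_zero (e : Fin 3 → ℕ) {x : FreeAlgebra k (Fin 3)}
    (hx : x ∈ nicholsIdeal (braidingR11 t a b p)) : derivFunctional t a b p e x = 0 :=
  algebraMapInv_eq_zero_of_mem_nicholsIdeal <| skewDeriv_pow_mem_nicholsIdeal _ _ <|
    skewDeriv_pow_mem_nicholsIdeal _ _ <| skewDeriv_pow_mem_nicholsIdeal _ _ hx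

/-- The ordered monomial `x_1^{e_1} x_2^{e_2} x_3^{e_3}` in the free algebra. -/
def freeMonomial (k : Type*) [Field k] (e : Fin 3 → ℕ) : FreeAlgebra k (Fin 3) :=
  X 0 ^ e 0 * (X 1 ^ e 1 * X 2 ^ e 2)

theorem skewDeriv_two_pow_freeMonomial (n : ℕ) (e : Fin 3 → ℕ) :
    (skewDeriv (braidingR11 t a b p) 2 ^ n) (freeMonomial k e) =
      X 0 ^ e 0 * (X 1 ^ e 1 * (skewDeriv (braidingR11 t a b p) 2 ^ n) (X 2 ^ e 2)) := by
  rw [freeMonomial, skewDeriv_pow_ι_pow_mul (letterBraiding_R11_eq_zero (by decide)),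
    skewDeriv_pow_ι_pow_mul (letterBraiding_R11_eq_zero (by decide))]

/-- The last diagonal entry of `L(x_3)` is `t x_3 - t b x_1`, so the argument used for powers of
`x_1` and `x_2` does not apply; modulo `x_1` and `x_2` the entry is `t x_3`. -/
theorem skewDeriv_two_pow_X_pow (n : ℕ) :
    (skewDeriv (braidingR11 t a b p) 2 ^ n) (X 2 ^ n) = qFactorial t n • 1 := by
  rw [skewDeriv_pow_of_mem_tensorPower (t := t) (fun i hi => letterBraiding_R11_eq_zero (by omega))
    (fun i => ?_) (ι_pow_mem_tensorPower 2 n)]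
  · simp [letterCharacter_ι]
  · have := letterBraiding_R11_X (t := t) (a := a) (b := b) (p := p) i
    simp only [X] at this
    rw [this]
    fin_cases i <;> simp [matrixR11, letterCharacter_ι]

/-- The index of an ordered monomial, reordered so that the lexicographic order compares the
exponents of `x_3`, `x_2`, `x_1` in turn. -/
def monomialKey (e : Fin 3 → ℕ) : ℕ ×ₗ ℕ ×ₗ ℕ := toLex (e 2, toLex (e 1, e 0))

theorem monomialKey_injective : Function.Injective monomialKey := by
  intro e e' h
  simp only [monomialKey, EmbeddingLike.apply_eq_iff_eq, Prod.mk.injEq] at h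
  funext i
  fin_cases i
  exacts [h.2.2, h.2.1, h.1]

/-- The derivations act in the order `∂_3`, `∂_2`, `∂_1`, each passing over the letters to the left
of its own. At the first exponent that differs, more derivatives are taken than the degree allows.
-/
theorem derivFunctional_freeMonomial_of_lt {e e' : Fin 3 → ℕ}
    (h : monomialKey e' < monomialKey e) :
    derivFunctional t a b p e (freeMonomial k e') = 0 := by
  simp only [derivFunctional, LinearMap.comp_apply, Module.End.mul_apply,
    skewDeriv_two_pow_freeMonomial, AlgHom.toLinearMap_apply]
  rw [monomialKey, monomialKey, Prod.Lex.toLex_lt_toLex, Prod.Lex.toLex_lt_toLex] at h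
  rcases h with h | ⟨h2, h | ⟨h1, h⟩⟩
  · rw [skewDeriv_pow_eq_zero _ _ h (ι_pow_mem_tensorPower 2 _)]; simp
  all_goals
    dsimp only at h2 h
    rw [h2, skewDeriv_two_pow_X_pow, mul_smul_comm, mul_smul_comm, mul_one, map_smul,
      skewDeriv_pow_ι_pow_mul (letterBraiding_R11_eq_zero (by decide))]
  · rw [skewDeriv_pow_eq_zero _ _ h (ι_pow_mem_tensorPower 1 _)]; simp
  · dsimp only at h1
    rw [h1, skewDeriv_pow_ι_pow letterBraiding_R11_one_pow, mul_smul_comm, mul_one, smul_smul,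
      map_smul, skewDeriv_pow_eq_zero _ _ h (ι_pow_mem_tensorPower 0 _)]
    simp

theorem derivFunctional_freeMonomial_self (e : Fin 3 → ℕ) :
    derivFunctional t a b p e (freeMonomial k e) =
      qFactorial t (e 2) * qFactorial t (e 1) * qFactorial t (e 0) := by
  simp only [derivFunctional, LinearMap.comp_apply, Module.End.mul_apply,
    skewDeriv_two_pow_freeMonomial, AlgHom.toLinearMap_apply]
  rw [skewDeriv_two_pow_X_pow, mul_smul_comm, mul_smul_comm, mul_one, map_smul,
    skewDeriv_pow_ι_pow_mul (letterBraiding_R11_eq_zero (by decide)),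
    skewDeriv_pow_ι_pow letterBraiding_R11_one_pow, mul_smul_comm, mul_one, smul_smul,
    map_smul, skewDeriv_pow_ι_pow letterBraiding_R11_zero_pow]
  simp

/-- The quotient map from the tensor algebra to the Nichols algebra. -/
def NicholsAlgebra.mk {ι : Type*} [Fintype ι] [DecidableEq ι] (r : ι → ι → ι → ι → k) :
    FreeAlgebra k ι →ₐ[k] NicholsAlgebra r :=
  (nicholsIdeal r).ringCon.mkₐ k

theorem NicholsAlgebra.mk_eq_zero_iff {ι : Type*} [Fintype ι] [DecidableEq ι]
    {r : ι → ι → ι → ι → k} {x : FreeAlgebra k ι} :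
    NicholsAlgebra.mk r x = 0 ↔ x ∈ nicholsIdeal r := by
  conv_rhs => rw [← TwoSidedIdeal.ker_ringCon_mk' (nicholsIdeal r), TwoSidedIdeal.mem_ker]
  rfl

theorem NicholsAlgebra.mk_surjective {ι : Type*} [Fintype ι] [DecidableEq ι]
    (r : ι → ι → ι → ι → k) : Function.Surjective (NicholsAlgebra.mk r) :=
  RingCon.mkₐ_surjective _

theorem NicholsAlgebra.mk_freeMonomial (r : Fin 3 → Fin 3 → Fin 3 → Fin 3 → k) (e : Fin 3 → ℕ) :
    NicholsAlgebra.mk r (freeMonomial k e) = orderedMonomial r e := by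
  rw [freeMonomial, ← mul_assoc, map_mul, map_mul, map_pow, map_pow, map_pow]
  rfl

/-- Ordered monomials are linearly independent in the Nichols algebra, as long as the
`q`-factorials of the exponents do not vanish. -/
theorem linearIndependent_orderedMonomial {α : Type*} (f : α → Fin 3 → ℕ)
    (hf : Function.Injective f) (h : ∀ e i, qFactorial t (f e i) ≠ 0) :
    LinearIndependent k fun e : α => orderedMonomial (braidingR11 t a b p) (f e) := by
  simp_rw [← NicholsAlgebra.mk_freeMonomial]
  refine linearIndependent_of_triangular (fun e => monomialKey (f e))
    (monomialKey_injective.comp hf) (NicholsAlgebra.mk _).toLinearMap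
    (fun e => freeMonomial k (f e)) (fun e => derivFunctional t a b p (f e)) ?_ ?_ ?_
  · exact fun e x hx => derivFunctional_eq_zero _ (NicholsAlgebra.mk_eq_zero_iff.mp hx)
  · exact fun e e' h => derivFunctional_freeMonomial_of_lt h
  · intro e
    rw [derivFunctional_freeMonomial_self]
    exact mul_ne_zero (mul_ne_zero (h _ _) (h _ _)) (h _ _)

end R11

end BraidedNichols

namespace BraidedNichols

/-! ### Relations between the operators that describe the braiding -/

section OperatorRelations

variable {k : Type*} [Field k]

/-- The exchange relations between left multiplications `x_j` and the entries
`g, d, e, f, h` of the matrix `[[g, 0, 0], [d, g, 0], [f, e, h]]` of operators which describes the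
braiding. -/
structure ExchangeRelations {E : Type*} [Ring E] [Algebra k E] (t a b p : k) (x : Fin 3 → E)
    (g d e f h : E) : Prop where
  g0 : g * x 0 = t • (x 0 * g)
  g1 : g * x 1 = t • (x 1 * g)
  g2 : g * x 2 = t • (x 2 * g) - (t * a) • (x 0 * g)
  d0 : d * x 0 = t • (x 0 * d)
  d1 : d * x 1 = t • (x 1 * d)
  d2 : d * x 2 = (t * (b - a)) • (x 1 * g) + t • (x 2 * d) - (t * a) • (x 0 * d)
  e0 : e * x 0 = t • (x 0 * e)
  e1 : e * x 1 = (t * (a - b)) • (x 0 * g) + t • (x 1 * e)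
  e2 : e * x 2 = (t * p) • (x 0 * g) + t • (x 2 * e) - (t * b) • (x 0 * e)
  f0 : f * x 0 = (t * a) • (x 0 * g) + t • (x 0 * f)
  f1 : f * x 1 = (t * a) • (x 1 * g) + (t * (a - b)) • (x 0 * d) + t • (x 1 * f)
  f2 : f * x 2 = (t * b) • (x 2 * g) - (t * a * b) • (x 0 * g) - (t * p) • (x 1 * g) +
    (t * p) • (x 0 * d) + t • (x 2 * f) - (t * b) • (x 0 * f)
  h0 : h * x 0 = t • (x 0 * h)
  h1 : h * x 1 = t • (x 1 * h)
  h2 : h * x 2 = t • (x 2 * h) - (t * b) • (x 0 * h)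

/-- The commutation relations between the operators which describe the braiding; they are
equivalent to the braid equation. -/
structure CommutationRelations {E : Type*} [Ring E] [Algebra k E] (a b p : k)
    (g d e f h : E) : Prop where
  dg : d * g = g * d
  eg : e * g = g * e
  hg : h * g = g * h
  hd : h * d = d * h
  he : h * e = e * h
  fg : f * g = g * f + a • (g * g) - a • (g * h)
  fd : f * d = d * f + (2 * a - b) • (g * d) - a • (d * h)
  ed : e * d = d * e + (b - a) • (g * h) - (b - a) • (g * g)
  fh : f * h = h * f + b • (g * h) - b • (h * h)
  fe : f * e = e * f + p • (h * h) - p • (g * g) + b • (g * e) - b • (e * h)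

/-- Endomorphisms of an algebra generated by `x_1, x_2, x_3` with the exchange relations satisfy
the commutation relations. -/
theorem ExchangeRelations.commutationRelations {B : Type*} [Ring B] [Algebra k B] {t a b p : k}
    {x : Fin 3 → B} {g d e f h : Module.End k B}
    (H : ExchangeRelations t a b p (fun i => LinearMap.mulLeft k (x i)) g d e f h)
    (g_one : g 1 = 1) (d_one : d 1 = 0) (e_one : e 1 = 0) (f_one : f 1 = 0) (h_one : h 1 = 1)
    (hx : Function.Surjective (FreeAlgebra.lift k x)) :
    CommutationRelations a b p g d e f h := by
  have G0 (v) := LinearMap.congr_fun H.g0 v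
  have G1 (v) := LinearMap.congr_fun H.g1 v
  have G2 (v) := LinearMap.congr_fun H.g2 v
  have D0 (v) := LinearMap.congr_fun H.d0 v
  have D1 (v) := LinearMap.congr_fun H.d1 v
  have D2 (v) := LinearMap.congr_fun H.d2 v
  have E0 (v) := LinearMap.congr_fun H.e0 v
  have E1 (v) := LinearMap.congr_fun H.e1 v
  have E2 (v) := LinearMap.congr_fun H.e2 v
  have F0 (v) := LinearMap.congr_fun H.f0 v
  have F1 (v) := LinearMap.congr_fun H.f1 v
  have F2 (v) := LinearMap.congr_fun H.f2 v
  have H0 (v) := LinearMap.congr_fun H.h0 v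
  have H1 (v) := LinearMap.congr_fun H.h1 v
  have H2 (v) := LinearMap.congr_fun H.h2 v
  simp only [Module.End.mul_apply, LinearMap.mulLeft_apply, LinearMap.smul_apply,
    LinearMap.add_apply, LinearMap.sub_apply] at G0 G1 G2 D0 D1 D2 E0 E1 E2 F0 F1 F2 H0 H1 H2
  -- The ten identities are proved together by induction on words: moving a letter to the left past
  -- two operators produces other products of two operators applied to the shorter word, which are
  -- reordered by the other identities.
  have key : ∀ v, d (g v) = g (d v) ∧ e (g v) = g (e v) ∧ h (g v) = g (h v) ∧ h (d v) = d (h v) ∧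
      h (e v) = e (h v) ∧ f (g v) = g (f v) + a • g (g v) - a • g (h v) ∧
      f (d v) = d (f v) + (2 * a - b) • g (d v) - a • d (h v) ∧
      e (d v) = d (e v) + (b - a) • g (h v) - (b - a) • g (g v) ∧
      f (h v) = h (f v) + b • g (h v) - b • h (h v) ∧
      f (e v) = e (f v) + p • h (h v) - p • g (g v) + b • g (e v) - b • e (h v) := by
    rw [hx.forall]
    intro y
    induction y using freeAlgebra_induction_left with
    | one => simp [g_one, d_one, e_one, f_one, h_one]
    | add y z hy hz =>
      simp only [map_add, smul_add] at hy hz ⊢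
      obtain ⟨y1, y2, y3, y4, y5, y6, y7, y8, y9, y10⟩ := hy
      obtain ⟨z1, z2, z3, z4, z5, z6, z7, z8, z9, z10⟩ := hz
      rw [y1, y2, y3, y4, y5, y6, y7, y8, y9, y10, z1, z2, z3, z4, z5, z6, z7, z8, z9, z10]
      refine ⟨rfl, rfl, rfl, rfl, rfl, ?_, ?_, ?_, ?_, ?_⟩ <;> abel
    | smul s y hy =>
      simp only [map_smul] at hy ⊢
      obtain ⟨y1, y2, y3, y4, y5, y6, y7, y8, y9, y10⟩ := hy
      rw [y1, y2, y3, y4, y5, y6, y7, y8, y9, y10]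
      refine ⟨rfl, rfl, rfl, rfl, rfl, ?_, ?_, ?_, ?_, ?_⟩ <;> module
    | mul i y hy =>
      rw [map_mul, FreeAlgebra.lift_ι_apply]
      generalize FreeAlgebra.lift k x y = v at hy ⊢
      obtain ⟨y1, y2, y3, y4, y5, y6, y7, y8, y9, y10⟩ := hy
      have hi : i = 0 ∨ i = 1 ∨ i = 2 := by omega
      rcases hi with rfl | rfl | rfl <;>
      · refine ⟨?_, ?_, ?_, ?_, ?_, ?_, ?_, ?_, ?_, ?_⟩ <;>
        · simp only [G0, G1, G2, D0, D1, D2, E0, E1, E2, F0, F1, F2, H0, H1, H2, map_add, map_sub,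
            map_smul, y1, y2, y3, y4, y5, y6, y7, y8, y9, y10, mul_add, mul_sub, mul_smul_comm]
          try module
  constructor <;> refine LinearMap.ext fun v => ?_ <;>
    obtain ⟨y1, y2, y3, y4, y5, y6, y7, y8, y9, y10⟩ := key v <;> assumption

/-- The commutation relations of the Nichols algebra for `t = 1`. -/
structure SymmetricRelations {A : Type*} [Ring A] [Algebra k A] (a b : k) (x : Fin 3 → A) :
    Prop where
  h10 : x 1 * x 0 = x 0 * x 1
  h20 : x 2 * x 0 = x 0 * x 2 + a • (x 0 * x 0)
  h21 : x 2 * x 1 = x 1 * x 2 + (2 * a - b) • (x 0 * x 1)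

/-- The commutation relations of the Nichols algebra for `t = -1`. -/
structure ExteriorRelations {A : Type*} [Ring A] [Algebra k A] (b p : k) (x : Fin 3 → A) :
    Prop where
  h10 : x 1 * x 0 = -(x 0 * x 1)
  h20 : x 2 * x 0 = -(x 0 * x 2)
  h21 : x 2 * x 1 = b • (x 0 * x 1) - x 1 * x 2
  h00 : x 0 * x 0 = 0
  h11 : x 1 * x 1 = 0
  h22 : x 2 * x 2 = b • (x 0 * x 2) - p • (x 0 * x 1)

variable {E A : Type*} [Ring E] [Algebra k E] [Ring A] [Algebra k A] {a b p : k}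
  {y : Fin 3 → E} {x : Fin 3 → A} {g d e f h : E}

/-- The letters acting on the tensor square. -/
def tensorLetters (y : Fin 3 → E) (x : Fin 3 → A) (g d e f h : E) : Fin 3 → E ⊗[k] A :=
  ![y 0 ⊗ₜ 1 + g ⊗ₜ x 0, y 1 ⊗ₜ 1 + (d ⊗ₜ x 0 + g ⊗ₜ x 1),
    y 2 ⊗ₜ 1 + (f ⊗ₜ x 0 + e ⊗ₜ x 1 + h ⊗ₜ x 2)]

/-- After expansion, `H` moves operators to the right of the `y_i`, `C` orders the operators, and
`Hy` and `Hx` order the letters in the two factors. All terms are then in normal form and cancel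
linearly. -/
theorem SymmetricRelations.tensor (Hy : SymmetricRelations a b y) (Hx : SymmetricRelations a b x)
    (H : ExchangeRelations 1 a b p y g d e f h) (C : CommutationRelations a b p g d e f h) :
    SymmetricRelations a b (tensorLetters (k := k) y x g d e f h) := by
  constructor <;>
  · simp only [tensorLetters, Matrix.cons_val, mul_add, add_mul,
      Algebra.TensorProduct.tmul_mul_tmul, mul_one, one_mul, Hy.h10, Hy.h20, Hy.h21, Hx.h10,
      Hx.h20, Hx.h21, H.g0, H.g1, H.g2, H.d0, H.d2, H.e0, H.e1, H.f0, H.f1, H.h0, H.h1, C.dg, C.eg,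
      C.hg, C.hd, C.fg, C.fd, C.ed, TensorProduct.tmul_add, TensorProduct.add_tmul,
      TensorProduct.sub_tmul, TensorProduct.tmul_smul, ← TensorProduct.smul_tmul', smul_add]
    module

theorem ExteriorRelations.tensor (Hy : ExteriorRelations b p y) (Hx : ExteriorRelations b p x)
    (H : ExchangeRelations (-1) a b p y g d e f h) (C : CommutationRelations a b p g d e f h) :
    ExteriorRelations b p (tensorLetters (k := k) y x g d e f h) := by
  constructor <;>
  · simp only [tensorLetters, Matrix.cons_val, mul_add, add_mul,
      Algebra.TensorProduct.tmul_mul_tmul, mul_one, one_mul, Hy.h10, Hy.h20, Hy.h21, Hy.h00,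
      Hy.h11, Hy.h22, Hx.h10, Hx.h20, Hx.h21, Hx.h00, Hx.h11, Hx.h22, H.g0, H.g1, H.g2, H.d0, H.d1,
      H.d2, H.e0, H.e1, H.e2, H.f0, H.f1, H.f2, H.h0, H.h1, H.h2, C.dg, C.eg, C.hg, C.hd, C.he,
      C.fg, C.fd, C.ed, C.fh, C.fe, TensorProduct.add_tmul, TensorProduct.tmul_sub,
      TensorProduct.sub_tmul, TensorProduct.tmul_smul, TensorProduct.tmul_zero,
      TensorProduct.zero_tmul, TensorProduct.tmul_neg, TensorProduct.neg_tmul,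
      ← TensorProduct.smul_tmul', smul_add, smul_sub, smul_zero]
    module

/-- This makes `x_j ↦ L(x_j)` factor through the presented algebra: the braiding descends to the
quotient. -/
theorem SymmetricRelations.matrixR11 (Hx : SymmetricRelations a b x) :
    SymmetricRelations a b (matrixR11 1 a b p x) := by
  constructor <;>
  · ext i l
    fin_cases i <;> fin_cases l <;>
    · simp only [BraidedNichols.matrixR11, Matrix.mul_apply, Fin.sum_univ_three, Matrix.of_apply,
        Matrix.cons_val, Matrix.add_apply, Matrix.smul_apply, Fin.mk_zero, Fin.mk_one,
        Fin.reduceFinMk, mul_zero, zero_mul, add_zero, zero_add, smul_zero, one_mul, one_smul,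
        mul_sub, sub_mul, mul_smul_comm, smul_mul_assoc, Hx.h10, Hx.h20, Hx.h21,
        smul_add]
      try module

theorem ExteriorRelations.matrixR11 (Hx : ExteriorRelations b p x) :
    ExteriorRelations b p (matrixR11 (-1) a b p x) := by
  constructor <;>
  · ext i l
    fin_cases i <;> fin_cases l <;>
    · simp only [BraidedNichols.matrixR11, Matrix.mul_apply, Fin.sum_univ_three, Matrix.of_apply,
        Matrix.cons_val, Matrix.sub_apply, Matrix.neg_apply, Matrix.zero_apply,
        Matrix.smul_apply, Fin.mk_zero, Fin.mk_one,
        Fin.reduceFinMk, mul_zero, zero_mul, add_zero, zero_add, smul_zero, neg_smul, one_smul,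
        mul_sub, sub_mul, mul_smul_comm, smul_mul_assoc, neg_mul, mul_neg,
        Hx.h10, Hx.h20, Hx.h21, Hx.h00, Hx.h11, Hx.h22, smul_add, smul_neg, smul_sub]
      try module

end OperatorRelations

end BraidedNichols

namespace BraidedNichols

/-! ### A criterion for Hopf ideals in terms of the quotient algebra -/

section Quotient

variable {k : Type*} [Field k]

/-- By right exactness of the tensor product, `ker (π ⊗ π)` is the sum of the images of `B ⊗ ker π`
and `ker π ⊗ B`. -/
theorem mem_span_tmul_of_map_eq_zero {B A : Type*} [Ring B] [Algebra k B] [Ring A] [Algebra k A]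
    (π : B →ₐ[k] A) (hπ : Function.Surjective π) {z : B ⊗[k] B}
    (hz : TensorProduct.map π.toLinearMap π.toLinearMap z = 0) :
    z ∈ Submodule.span k {z : B ⊗[k] B | ∃ u v, (π u = 0 ∨ π v = 0) ∧ z = u ⊗ₜ[k] v} := by
  have hex : Function.Exact (LinearMap.ker π.toLinearMap).subtype π.toLinearMap :=
    LinearMap.exact_subtype_ker_map π.toLinearMap
  have := TensorProduct.map_ker hex hπ hex hπ
  rw [← LinearMap.mem_ker, this] at hz
  refine SetLike.le_def.mp (sup_le ?_ ?_) hz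
  · rintro _ ⟨w, rfl⟩
    induction w using TensorProduct.induction_on with
    | zero => rw [map_zero]; exact zero_mem _
    | tmul u v => exact Submodule.subset_span ⟨u, v, Or.inr v.2, rfl⟩
    | add u v hu hv => rw [map_add]; exact add_mem hu hv
  · rintro _ ⟨w, rfl⟩
    induction w using TensorProduct.induction_on with
    | zero => rw [map_zero]; exact zero_mem _
    | tmul u v => exact Submodule.subset_span ⟨u, v, Or.inl u.2, rfl⟩
    | add u v hu hv => rw [map_add]; exact add_mem hu hv

variable {ι : Type*} [Fintype ι] [DecidableEq ι] {A : Type*} [Ring A] [Algebra k A]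

/-- The operators `y ↦ L(y)_{il}` defined by a matrix representation `L`. -/
def entryOperator (L : A →ₐ[k] Matrix ι ι A) (i l : ι) : Module.End k A :=
  Matrix.entryLinearMap k A i l ∘ₗ L.toLinearMap

theorem entryOperator_apply (L : A →ₐ[k] Matrix ι ι A) (i l : ι) (v : A) :
    entryOperator L i l v = L v i l := rfl

/-- The action of `End A ⊗ A` on `A ⊗ A`, the second factor acting by left multiplication. -/
def tensorAction (k A : Type*) [Field k] [Ring A] [Algebra k A] :
    Module.End k A ⊗[k] A →ₐ[k] Module.End k (A ⊗[k] A) :=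
  (Module.endTensorEndAlgHom (R := k) (S := k) (A := k)).comp
    (Algebra.TensorProduct.map (AlgHom.id k _) (Algebra.lmul k A))

theorem tensorAction_tmul (φ : Module.End k A) (u v w : A) :
    tensorAction k A (φ ⊗ₜ u) (v ⊗ₜ w) = φ v ⊗ₜ (u * w) := rfl

/-- The ideal generated by homogeneous elements `S` of degree at least two is a Hopf ideal if the
braiding descends to the quotient `A` and the elements of `S` act by zero on `A ⊗ A`. -/
theorem isHopfIdeal_span {r : ι → ι → ι → ι → k} {S : Set (FreeAlgebra k ι)}
    (hS : ∀ s ∈ S, ∃ n, 2 ≤ n ∧ s ∈ tensorPower k ι n) (π : FreeAlgebra k ι →ₐ[k] A)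
    (hπ : Function.Surjective π) (hker : ∀ y, π y = 0 ↔ y ∈ TwoSidedIdeal.span S)
    (L : A →ₐ[k] Matrix ι ι A) (hL : ∀ y i l, L (π y) i l = π (letterBraiding r y i l))
    (hD : ∀ s ∈ S, FreeAlgebra.lift k (fun i =>
      LinearMap.mulLeft k (π (FreeAlgebra.ι k i)) ⊗ₜ[k] (1 : A) +
        ∑ l, entryOperator L i l ⊗ₜ[k] π (FreeAlgebra.ι k l)) s = 0) :
    IsHopfIdeal r (TwoSidedIdeal.span S) := by
  constructor
  · refine le_antisymm (TwoSidedIdeal.span_mono fun s hs =>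
      ⟨TwoSidedIdeal.subset_span hs, hS s hs⟩) (TwoSidedIdeal.span_le.mpr fun s hs => hs.1)
  · intro y hy
    set D := FreeAlgebra.lift k (fun i =>
      LinearMap.mulLeft k (π (FreeAlgebra.ι k i)) ⊗ₜ[k] (1 : A) +
        ∑ l, entryOperator L i l ⊗ₜ[k] π (FreeAlgebra.ι k l)) with hDdef
    have hDι : ∀ i, D (FreeAlgebra.ι k i) = LinearMap.mulLeft k (π (FreeAlgebra.ι k i)) ⊗ₜ[k] 1 +
        ∑ l, entryOperator L i l ⊗ₜ[k] π (FreeAlgebra.ι k l) := fun i =>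
      FreeAlgebra.lift_ι_apply _ _
    have letter : ∀ i z, TensorProduct.map π.toLinearMap π.toLinearMap
        (mulLeftLetter i z + mulRightLetter r i z) = tensorAction k A (D (FreeAlgebra.ι k i))
          (TensorProduct.map π.toLinearMap π.toLinearMap z) := by
      intro i z
      induction z using TensorProduct.induction_on with
      | zero => simp
      | tmul u v =>
        simp [hDι, mulLeftLetter, mulRightLetter, LinearMap.sum_apply, tensorAction_tmul,
          entryOperator_apply, hL]
      | add u v hu hv =>
        simp only [map_add] at hu hv ⊢
        rw [← hu, ← hv]; abel
    -- Modulo the ideal, the coproduct of `y` is `D y` applied to `1 ⊗ 1`. As `D` is an algebra map,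
    -- it kills the whole ideal once it kills `S`.
    have comp : ∀ y, TensorProduct.map π.toLinearMap π.toLinearMap (comul r y) =
        tensorAction k A (D y) (1 ⊗ₜ 1) := by
      intro y
      induction y using freeAlgebra_induction_left with
      | one => simp [comul_one]
      | add x y hx hy => simp only [map_add, hx, hy, LinearMap.add_apply]
      | smul s x hx => simp only [map_smul, hx, LinearMap.smul_apply]
      | mul i x hx => rw [comul_ι_mul, letter, hx, map_mul, map_mul, Module.End.mul_apply]
    have hle : TwoSidedIdeal.span S ≤ TwoSidedIdeal.ker D := TwoSidedIdeal.span_le.mpr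
      fun s hs => (TwoSidedIdeal.mem_ker _).mpr (hD s hs)
    have hy0 : D y = 0 := (TwoSidedIdeal.mem_ker _).mp (hle hy)
    have := mem_span_tmul_of_map_eq_zero π hπ (z := comul r y)
      (by rw [comp, hy0, map_zero, LinearMap.zero_apply])
    simpa only [hker] using this

end Quotient

/-! ### The quadratic relations generate Hopf ideals -/

section R11

variable {k : Type*} [Field k] {t a b p : k}

theorem mapMatrix_letterBraiding_R11 {A : Type*} [Ring A] [Algebra k A]
    (π : FreeAlgebra k (Fin 3) →ₐ[k] A) (y : FreeAlgebra k (Fin 3)) (i l : Fin 3) :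
    π (letterBraiding (braidingR11 t a b p) y i l) =
      FreeAlgebra.lift k (matrixR11 t a b p fun i => π (X i)) y i l := by
  have : π.mapMatrix.comp (letterBraiding (braidingR11 t a b p)) =
      FreeAlgebra.lift k (matrixR11 t a b p fun i => π (X i)) := by
    refine FreeAlgebra.hom_ext (funext fun j => ?_)
    have := letterBraiding_R11_X (t := t) (a := a) (b := b) (p := p) j
    simp only [X] at this
    simp only [Function.comp_apply, AlgHom.comp_apply, this, FreeAlgebra.lift_ι_apply]
    ext i l
    fin_cases j <;> fin_cases i <;> fin_cases l <;>
      simp only [matrixR11, AlgHom.mapMatrix_apply, Matrix.map_apply, Matrix.of_apply,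
        Matrix.cons_val, Fin.mk_zero, Fin.mk_one, Fin.reduceFinMk, map_zero, map_smul, map_sub]
  rw [← this]
  rfl

/-- Triangularity of `L` passes to the quotient, so multiplicativity of `L` on `x_j v` is exactly a
set of exchange relations for five entries. The hypothesis `hT` then only concerns abstract
operators with known relations. -/
theorem isHopfIdeal_R11 {S : Set (FreeAlgebra k (Fin 3))}
    (hS : ∀ s ∈ S, ∃ n, 2 ≤ n ∧ s ∈ tensorPower k (Fin 3) n) {A : Type*} [Ring A] [Algebra k A]
    (π : FreeAlgebra k (Fin 3) →ₐ[k] A) (hπ : Function.Surjective π)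
    (hker : ∀ y, π y = 0 ↔ y ∈ TwoSidedIdeal.span S)
    (L : A →ₐ[k] Matrix (Fin 3) (Fin 3) A)
    (hL : ∀ y, L (π y) = FreeAlgebra.lift k (matrixR11 t a b p fun i => π (X i)) y)
    (hT : ∀ g d e f h : Module.End k A,
      ExchangeRelations t a b p (fun i => LinearMap.mulLeft k (π (X i))) g d e f h →
      CommutationRelations a b p g d e f h → ∀ s ∈ S, FreeAlgebra.lift k (tensorLetters (k := k)
        (fun i => LinearMap.mulLeft k (π (X i))) (fun i => π (X i)) g d e f h) s = 0) :
    IsHopfIdeal (braidingR11 t a b p) (TwoSidedIdeal.span S) := by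
  have hL' : ∀ y i l, L (π y) i l = π (letterBraiding (braidingR11 t a b p) y i l) := fun y i l =>
    by rw [mapMatrix_letterBraiding_R11, hL]
  have tri : ∀ v, L v 0 1 = 0 ∧ L v 0 2 = 0 ∧ L v 1 2 = 0 ∧ L v 1 1 = L v 0 0 := by
    rw [hπ.forall]
    intro y
    obtain ⟨h1, h2, h3, h4⟩ := letterBraiding_R11_triangular (t := t) (a := a) (b := b) (p := p) y
    simp only [hL', h1, h2, h3, h4, map_zero, and_self]
  have hLX : ∀ j, L (π (X j)) = matrixR11 t a b p (fun i => π (X i)) j := fun j => by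
    rw [hL]; exact FreeAlgebra.lift_ι_apply _ _
  have ex : ExchangeRelations t a b p (fun i => LinearMap.mulLeft k (π (X i)))
      (entryOperator L 0 0) (entryOperator L 1 0) (entryOperator L 2 1) (entryOperator L 2 0)
      (entryOperator L 2 2) := by
    constructor <;> refine LinearMap.ext fun v => ?_ <;>
      obtain ⟨h1, h2, h3, h4⟩ := tri v <;>
      simp only [Module.End.mul_apply, LinearMap.mulLeft_apply, LinearMap.smul_apply,
        LinearMap.add_apply, LinearMap.sub_apply, entryOperator_apply, map_mul, hLX,
        Matrix.mul_apply, Fin.sum_univ_three, matrixR11, Matrix.of_apply, Matrix.cons_val, h1, h2,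
        h3, h4, zero_mul, mul_zero, add_zero, zero_add, smul_mul_assoc, sub_mul] <;>
      try abel
  have lift_eq : FreeAlgebra.lift k (fun i => π (X i)) = π := FreeAlgebra.lift_comp_ι π
  have comm := ex.commutationRelations (by simp [entryOperator_apply])
    (by simp [entryOperator_apply]) (by simp [entryOperator_apply])
    (by simp [entryOperator_apply]) (by simp [entryOperator_apply]) (by rwa [lift_eq])
  refine isHopfIdeal_span hS π hπ hker L hL' fun s hs => ?_
  have e01 : entryOperator L 0 1 = 0 := LinearMap.ext fun v => (tri v).1
  have e02 : entryOperator L 0 2 = 0 := LinearMap.ext fun v => (tri v).2.1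
  have e12 : entryOperator L 1 2 = 0 := LinearMap.ext fun v => (tri v).2.2.1
  have e11 : entryOperator L 1 1 = entryOperator L 0 0 := LinearMap.ext fun v => (tri v).2.2.2
  rw [← hT _ _ _ _ _ ex comm s hs]
  congr 2
  funext i
  fin_cases i <;> simp [tensorLetters, Fin.sum_univ_three, e01, e02, e12, e11]

/-- Stated over any algebra, since it is used for the presented algebra, matrices over it, its left
multiplications, `End A ⊗ A` and the Nichols algebra. -/
theorem lift_relationsOne {B : Type*} [Ring B] [Algebra k B] (x : Fin 3 → B) :
    (∀ s ∈ relationsOne a b, FreeAlgebra.lift k x s = 0) ↔ SymmetricRelations a b x := by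
  simp only [relationsOne, Set.mem_insert_iff, Set.mem_singleton_iff, forall_eq_or_imp, forall_eq,
    map_add, map_sub, map_mul, map_smul, FreeAlgebra.lift_ι_apply, sq]
  constructor
  · rintro ⟨h1, h2, h3⟩
    refine ⟨?_, ?_, ?_⟩ <;> rw [← sub_eq_zero]
    · exact h1
    · rw [← h2]; module
    · rw [← h3]; module
  · rintro ⟨h1, h2, h3⟩
    refine ⟨?_, ?_, ?_⟩
    · rw [h1, sub_self]
    · rw [h2]; module
    · rw [h3]; module

theorem lift_relationsMinusOne {B : Type*} [Ring B] [Algebra k B] (x : Fin 3 → B) :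
    (∀ s ∈ relationsMinusOne b p, FreeAlgebra.lift k x s = 0) ↔ ExteriorRelations b p x := by
  simp only [relationsMinusOne, Set.mem_insert_iff, Set.mem_singleton_iff, forall_eq_or_imp,
    forall_eq, map_add, map_sub, map_mul, map_smul, FreeAlgebra.lift_ι_apply, sq]
  constructor
  · rintro ⟨h1, h2, h3, h4, h5, h6⟩
    refine ⟨?_, ?_, ?_, h4, h5, ?_⟩ <;> rw [← sub_eq_zero]
    · rw [← h1]; module
    · rw [← h2]; module
    · rw [← h3]; module
    · rw [← h6]; module
  · rintro ⟨h1, h2, h3, h4, h5, h6⟩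
    refine ⟨?_, ?_, ?_, h4, h5, ?_⟩
    · rw [h1]; module
    · rw [h2]; module
    · rw [h3]; module
    · rw [h6]; module

theorem X_mul_X_mem (i j : Fin 3) : (X i * X j : FreeAlgebra k (Fin 3)) ∈ tensorPower k (Fin 3) 2 :=
  mul_mem_tensorPower (m := 1) (n := 1) (ι_mem_tensorPower_one i) (ι_mem_tensorPower_one j)

theorem relationsOne_subset : relationsOne a b ⊆ (tensorPower k (Fin 3) 2 : Set _) := by
  rintro s (rfl | rfl | rfl)
  · exact sub_mem (X_mul_X_mem _ _) (X_mul_X_mem _ _)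
  · rw [sq]
    exact sub_mem (sub_mem (X_mul_X_mem _ _) (X_mul_X_mem _ _))
      (Submodule.smul_mem _ _ (X_mul_X_mem _ _))
  · exact add_mem (sub_mem (X_mul_X_mem _ _) (X_mul_X_mem _ _))
      (Submodule.smul_mem _ _ (X_mul_X_mem _ _))

theorem relationsMinusOne_subset : relationsMinusOne b p ⊆ (tensorPower k (Fin 3) 2 : Set _) := by
  rintro s (rfl | rfl | rfl | rfl | rfl | rfl)
  · exact add_mem (X_mul_X_mem _ _) (X_mul_X_mem _ _)
  · exact add_mem (X_mul_X_mem _ _) (X_mul_X_mem _ _)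
  · exact sub_mem (add_mem (X_mul_X_mem _ _) (X_mul_X_mem _ _))
      (Submodule.smul_mem _ _ (X_mul_X_mem _ _))
  · rw [sq]; exact X_mul_X_mem _ _
  · rw [sq]; exact X_mul_X_mem _ _
  · rw [sq]
    exact add_mem (sub_mem (X_mul_X_mem _ _) (Submodule.smul_mem _ _ (X_mul_X_mem _ _)))
      (Submodule.smul_mem _ _ (X_mul_X_mem _ _))

/-- The quotient map to the algebra with relations `S`. -/
def presentationMk (S : Set (FreeAlgebra k (Fin 3))) :
    FreeAlgebra k (Fin 3) →ₐ[k] (TwoSidedIdeal.span S).ringCon.Quotient :=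
  RingCon.mkₐ k _

theorem presentationMk_surjective (S : Set (FreeAlgebra k (Fin 3))) :
    Function.Surjective (presentationMk S) :=
  RingCon.mkₐ_surjective _

theorem presentationMk_eq_zero_iff {S : Set (FreeAlgebra k (Fin 3))} (y : FreeAlgebra k (Fin 3)) :
    presentationMk S y = 0 ↔ y ∈ TwoSidedIdeal.span S := by
  conv_rhs => rw [← TwoSidedIdeal.ker_ringCon_mk' (TwoSidedIdeal.span S), TwoSidedIdeal.mem_ker]
  rfl

theorem exists_presentation_lift {S : Set (FreeAlgebra k (Fin 3))} {B : Type*} [Ring B]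
    [Algebra k B] (x : Fin 3 → B) (h : ∀ s ∈ S, FreeAlgebra.lift k x s = 0) :
    ∃ L : (TwoSidedIdeal.span S).ringCon.Quotient →ₐ[k] B,
      ∀ y, L (presentationMk S y) = FreeAlgebra.lift k x y := by
  have hle : TwoSidedIdeal.span S ≤ TwoSidedIdeal.ker (FreeAlgebra.lift k x) :=
    TwoSidedIdeal.span_le.mpr fun s hs => (TwoSidedIdeal.mem_ker _).mpr (h s hs)
  exact ⟨RingCon.liftₐ _ (FreeAlgebra.lift k x) (TwoSidedIdeal.ringCon_le_iff.mp hle),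
    fun y => rfl⟩

theorem lift_presentationMk (S : Set (FreeAlgebra k (Fin 3))) :
    FreeAlgebra.lift k (fun i => presentationMk S (X i)) = presentationMk S :=
  FreeAlgebra.lift_comp_ι _

theorem presentation_relations (S : Set (FreeAlgebra k (Fin 3))) :
    ∀ s ∈ S, FreeAlgebra.lift k (fun i => presentationMk S (X i)) s = 0 := fun s hs => by
  rw [lift_presentationMk, presentationMk_eq_zero_iff]; exact TwoSidedIdeal.subset_span hs

theorem lift_mulLeft {A : Type*} [Ring A] [Algebra k A] (x : Fin 3 → A)
    (y : FreeAlgebra k (Fin 3)) :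
    FreeAlgebra.lift k (fun i => LinearMap.mulLeft k (x i)) y =
      LinearMap.mulLeft k (FreeAlgebra.lift k x y) := by
  have : FreeAlgebra.lift k (fun i => LinearMap.mulLeft k (x i)) =
      (Algebra.lmul k A).comp (FreeAlgebra.lift k x) := by
    refine FreeAlgebra.hom_ext (funext fun j => ?_)
    simp only [Function.comp_apply, AlgHom.comp_apply, FreeAlgebra.lift_ι_apply]
    rfl
  rw [this]
  rfl

theorem isHopfIdeal_relationsOne :
    IsHopfIdeal (braidingR11 1 a b p) (TwoSidedIdeal.span (relationsOne a b)) := by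
  have hx := (lift_relationsOne _).mp (presentation_relations (relationsOne a b))
  obtain ⟨L, hL⟩ := exists_presentation_lift _ ((lift_relationsOne _).mpr (hx.matrixR11 (p := p)))
  refine isHopfIdeal_R11 (fun s hs => ⟨2, le_rfl, relationsOne_subset hs⟩) _
    (presentationMk_surjective _) presentationMk_eq_zero_iff L hL fun g d e f h ex comm => ?_
  refine (lift_relationsOne _).mpr (SymmetricRelations.tensor ?_ hx ex comm)
  refine (lift_relationsOne _).mp fun s hs => ?_
  rw [lift_mulLeft, presentation_relations _ s hs, LinearMap.mulLeft_zero_eq_zero]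

theorem isHopfIdeal_relationsMinusOne :
    IsHopfIdeal (braidingR11 (-1) a b p) (TwoSidedIdeal.span (relationsMinusOne b p)) := by
  have hx := (lift_relationsMinusOne _).mp (presentation_relations (relationsMinusOne b p))
  obtain ⟨L, hL⟩ := exists_presentation_lift _
    ((lift_relationsMinusOne _).mpr (hx.matrixR11 (a := a)))
  refine isHopfIdeal_R11 (fun s hs => ⟨2, le_rfl, relationsMinusOne_subset hs⟩) _
    (presentationMk_surjective _) presentationMk_eq_zero_iff L hL fun g d e f h ex comm => ?_
  refine (lift_relationsMinusOne _).mpr (ExteriorRelations.tensor ?_ hx ex comm)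
  refine (lift_relationsMinusOne _).mp fun s hs => ?_
  rw [lift_mulLeft, presentation_relations _ s hs, LinearMap.mulLeft_zero_eq_zero]

end R11

end BraidedNichols

namespace BraidedNichols

/-! ### Straightening: ordered monomials span -/

section Straightening

variable {k : Type*} [Field k] {A : Type*} [Ring A] [Algebra k A] {a b p : k} {x : Fin 3 → A}

/-- The ordered monomial `x_1^{e_1} x_2^{e_2} x_3^{e_3}`. -/
def monomialOf (x : Fin 3 → A) (e : Fin 3 → ℕ) : A := x 0 ^ e 0 * (x 1 ^ e 1 * x 2 ^ e 2)

theorem monomialOf_presentationMk (S : Set (FreeAlgebra k (Fin 3))) (e : Fin 3 → ℕ) :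
    monomialOf (fun i => presentationMk S (X i)) e = presentationMk S (freeMonomial k e) := by
  simp [monomialOf, freeMonomial]

theorem monomialOf_gen (r : Fin 3 → Fin 3 → Fin 3 → Fin 3 → k) (e : Fin 3 → ℕ) :
    monomialOf (NicholsAlgebra.gen r) e = orderedMonomial r e :=
  (mul_assoc _ _ _).symm

theorem mul_mem_of_mem_span {y : A} {s : Set A} {W : Submodule k A} (h : ∀ z ∈ s, y * z ∈ W)
    {z : A} (hz : z ∈ Submodule.span k s) : y * z ∈ W := by
  have : Submodule.span k s ≤ W.comap (LinearMap.mulLeft k y) := Submodule.span_le.mpr h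
  exact this hz

theorem eq_top_of_letter_mul_mem (hx : Function.Surjective (FreeAlgebra.lift k x))
    {W : Submodule k A} (h1 : 1 ∈ W) (h : ∀ i, ∀ z ∈ W, x i * z ∈ W) : W = ⊤ := by
  rw [Submodule.eq_top_iff', hx.forall]
  intro y
  induction y using freeAlgebra_induction_left with
  | one => rwa [map_one]
  | add y z hy hz => rw [map_add]; exact add_mem hy hz
  | smul s y hy => rw [map_smul]; exact W.smul_mem _ hy
  | mul i y hy => rw [map_mul, FreeAlgebra.lift_ι_apply]; exact h i _ hy

variable (k) in
/-- The span of the ordered monomials of degree at most `m`. -/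
def monomialFiltration (x : Fin 3 → A) (m : ℕ) : Submodule k A :=
  Submodule.span k {z | ∃ e : Fin 3 → ℕ, e 0 + e 1 + e 2 ≤ m ∧ z = monomialOf x e}

theorem monomial_mem_filtration {m i j l : ℕ} (h : i + j + l ≤ m) :
    x 0 ^ i * (x 1 ^ j * x 2 ^ l) ∈ monomialFiltration k x m :=
  Submodule.subset_span ⟨![i, j, l], h, rfl⟩

/-- The commutator with `x_3` is a derivation sending `x_1` to `a x_1²`, which commutes with `x_1`.
-/
theorem SymmetricRelations.two_mul_zero_pow (H : SymmetricRelations a b x) (n : ℕ) :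
    x 2 * x 0 ^ n = x 0 ^ n * x 2 + (n * a) • x 0 ^ (n + 1) := by
  induction n with
  | zero => simp
  | succ n ih =>
    rw [pow_succ, ← mul_assoc, ih, add_mul, mul_assoc, H.h20, mul_add, smul_mul_assoc,
      mul_smul_comm, ← mul_assoc, ← mul_assoc, ← pow_succ, ← pow_succ]
    push_cast
    module

theorem SymmetricRelations.one_mul_zero_pow (H : SymmetricRelations a b x) (n : ℕ) :
    x 1 * x 0 ^ n = x 0 ^ n * x 1 :=
  Commute.pow_right H.h10 n

theorem SymmetricRelations.two_mul_one_pow (H : SymmetricRelations a b x) (n : ℕ) :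
    x 2 * x 1 ^ n = x 1 ^ n * x 2 + (n * (2 * a - b)) • (x 0 * x 1 ^ n) := by
  induction n with
  | zero => simp
  | succ n ih =>
    have h : x 1 ^ n * x 0 = x 0 * x 1 ^ n := Commute.pow_left H.h10 n
    rw [pow_succ, ← mul_assoc, ih, add_mul, mul_assoc, H.h21, mul_add, smul_mul_assoc,
      mul_smul_comm, ← mul_assoc, ← mul_assoc (x 1 ^ n), h, mul_assoc, mul_assoc]
    push_cast
    module

/-- The relations are homogeneous, so straightening raises the degree by one only. This control
gives both the spanning statement and the upper bound for growth. -/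
theorem SymmetricRelations.letter_mul_mem (H : SymmetricRelations a b x) (i : Fin 3) {m : ℕ}
    {z : A} (hz : z ∈ monomialFiltration k x m) : x i * z ∈ monomialFiltration k x (m + 1) := by
  refine mul_mem_of_mem_span ?_ hz
  rintro _ ⟨e, he, rfl⟩
  rw [monomialOf]
  have hi : i = 0 ∨ i = 1 ∨ i = 2 := by omega
  rcases hi with rfl | rfl | rfl
  · rw [← mul_assoc, ← pow_succ']
    exact monomial_mem_filtration (by omega)
  · rw [← mul_assoc, H.one_mul_zero_pow, mul_assoc, ← mul_assoc (x 1), ← pow_succ']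
    exact monomial_mem_filtration (by omega)
  · rw [← mul_assoc, H.two_mul_zero_pow, add_mul, mul_assoc, ← mul_assoc (x 2), H.two_mul_one_pow,
      add_mul, mul_assoc, ← pow_succ', mul_add, smul_mul_assoc, mul_smul_comm, smul_mul_assoc,
      mul_assoc (x 0), ← mul_assoc (x 0 ^ e 0) (x 0), ← pow_succ]
    exact add_mem (add_mem (monomial_mem_filtration (by omega))
      (Submodule.smul_mem _ _ (monomial_mem_filtration (by omega))))
      (Submodule.smul_mem _ _ (monomial_mem_filtration (by omega)))

theorem monomialFiltration_mono {m n : ℕ} (h : m ≤ n) :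
    monomialFiltration k x m ≤ monomialFiltration k x n :=
  Submodule.span_mono fun _ ⟨e, he, hz⟩ => ⟨e, he.trans h, hz⟩

theorem SymmetricRelations.span_eq_top (H : SymmetricRelations a b x)
    (hx : Function.Surjective (FreeAlgebra.lift k x)) :
    Submodule.span k (Set.range (monomialOf x)) = ⊤ := by
  refine eq_top_of_letter_mul_mem hx (Submodule.subset_span ⟨0, by simp [monomialOf]⟩) ?_
  intro i z hz
  refine mul_mem_of_mem_span ?_ hz
  rintro _ ⟨e, rfl⟩
  have hmem : monomialOf x e ∈ monomialFiltration k x (e 0 + e 1 + e 2) :=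
    Submodule.subset_span ⟨e, le_rfl, rfl⟩
  have hle : monomialFiltration k x (e 0 + e 1 + e 2 + 1) ≤
      Submodule.span k (Set.range (monomialOf x)) :=
    Submodule.span_mono fun _ ⟨e, _, hz⟩ => ⟨e, hz.symm⟩
  exact hle (H.letter_mul_mem i hmem)

theorem ExteriorRelations.span_eq_top (H : ExteriorRelations b p x)
    (hx : Function.Surjective (FreeAlgebra.lift k x)) :
    Submodule.span k (Set.range fun e : Fin 3 → Fin 2 => monomialOf x fun i => (e i : ℕ)) = ⊤ := by
  set W := Submodule.span k (Set.range fun e : Fin 3 → Fin 2 => monomialOf x fun i => (e i : ℕ))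
  have hm : ∀ i j l : Fin 2, x 0 ^ (i : ℕ) * (x 1 ^ (j : ℕ) * x 2 ^ (l : ℕ)) ∈ W := fun i j l =>
    Submodule.subset_span ⟨![i, j, l], rfl⟩
  have m000 : 1 ∈ W := by simpa using hm 0 0 0
  have m100 : x 0 ∈ W := by simpa using hm 1 0 0
  have m010 : x 1 ∈ W := by simpa using hm 0 1 0
  have m001 : x 2 ∈ W := by simpa using hm 0 0 1
  have m110 : x 0 * x 1 ∈ W := by simpa using hm 1 1 0
  have m101 : x 0 * x 2 ∈ W := by simpa using hm 1 0 1
  have m011 : x 1 * x 2 ∈ W := by simpa using hm 0 1 1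
  have m111 : x 0 * (x 1 * x 2) ∈ W := by simpa using hm 1 1 1
  have h00 (z : A) : x 0 * (x 0 * z) = 0 := by rw [← mul_assoc, H.h00, zero_mul]
  have h11 (z : A) : x 1 * (x 1 * z) = 0 := by rw [← mul_assoc, H.h11, zero_mul]
  have h10 (z : A) : x 1 * (x 0 * z) = -(x 0 * (x 1 * z)) := by
    rw [← mul_assoc, H.h10, neg_mul, mul_assoc]
  have h20 (z : A) : x 2 * (x 0 * z) = -(x 0 * (x 2 * z)) := by
    rw [← mul_assoc, H.h20, neg_mul, mul_assoc]
  have h21 (z : A) : x 2 * (x 1 * z) = b • (x 0 * (x 1 * z)) - x 1 * (x 2 * z) := by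
    rw [← mul_assoc, H.h21, sub_mul, smul_mul_assoc, mul_assoc, mul_assoc]
  refine eq_top_of_letter_mul_mem hx m000 ?_
  intro i z hz
  refine mul_mem_of_mem_span ?_ hz
  rintro _ ⟨e, rfl⟩
  have cases (j : Fin 3) : e j = 0 ∨ e j = 1 := by omega
  have hi : i = 0 ∨ i = 1 ∨ i = 2 := by omega
  -- Each of the 24 products of a letter and a squarefree ordered monomial is reduced by the
  -- rewriting rules to a combination of the eight monomials.
  rcases hi with rfl | rfl | rfl <;>
    rcases cases 0 with e0 | e0 <;> rcases cases 1 with e1 | e1 <;> rcases cases 2 with e2 | e2 <;>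
    simp only [monomialOf, e0, e1, e2, Fin.val_zero, Fin.val_one, pow_zero, pow_one, one_mul,
      mul_one, h00, h11, h10, h20, h21, H.h00, H.h11, H.h22, H.h10, H.h20, H.h21, mul_sub, mul_neg,
      mul_smul_comm, mul_zero, smul_zero, neg_zero, sub_zero, zero_sub, neg_neg] <;>
    first
    | assumption
    | exact zero_mem _
    | exact neg_mem ‹_›
    | exact sub_mem (Submodule.smul_mem _ _ ‹_›) (Submodule.smul_mem _ _ ‹_›)
    | exact sub_mem (Submodule.smul_mem _ _ ‹_›) ‹_›
    | exact sub_mem (Submodule.smul_mem _ _ ‹_›) (Submodule.smul_mem _ _ (neg_mem ‹_›))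

end Straightening

/-! ### Presentation of the Nichols algebra -/

section Presentation

variable {k : Type*} [Field k]

/-- An element of `J(V)` is, modulo the relations, a combination of ordered monomials. This
combination is again in `J(V)`, so independence in the Nichols algebra makes its coefficients zero.
-/
theorem nicholsIdeal_eq_span {r : Fin 3 → Fin 3 → Fin 3 → Fin 3 → k}
    {S : Set (FreeAlgebra k (Fin 3))} {α : Type*} (f : α → Fin 3 → ℕ)
    (hopf : IsHopfIdeal r (TwoSidedIdeal.span S))
    (hspan : Submodule.span k (Set.range fun e =>
      monomialOf (fun i => presentationMk S (X i)) (f e)) = ⊤)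
    (hind : LinearIndependent k fun e => orderedMonomial r (f e)) :
    nicholsIdeal r = TwoSidedIdeal.span S := by
  refine le_antisymm (fun y hy => ?_) hopf.le_nicholsIdeal
  have hmem : presentationMk S y ∈ Submodule.span k (Set.range fun e =>
      monomialOf (fun i => presentationMk S (X i)) (f e)) := hspan ▸ Submodule.mem_top
  obtain ⟨c, hc⟩ := (Finsupp.mem_span_range_iff_exists_finsupp).mp hmem
  have hc' : c.sum (fun e s => s • presentationMk S (freeMonomial k (f e))) =
      presentationMk S y := by
    rw [← hc]
    exact Finsupp.sum_congr fun e _ => by rw [monomialOf_presentationMk]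
  have hz : y - c.sum (fun e s => s • freeMonomial k (f e)) ∈ TwoSidedIdeal.span S := by
    rw [← presentationMk_eq_zero_iff, map_sub, sub_eq_zero, ← hc', map_finsuppSum]
    simp only [map_smul]
  have hz' : NicholsAlgebra.mk r (c.sum fun e s => s • freeMonomial k (f e)) = 0 := by
    rw [NicholsAlgebra.mk_eq_zero_iff]
    have := (nicholsIdeal r).sub_mem hy (hopf.le_nicholsIdeal hz)
    rwa [sub_sub_cancel] at this
  rw [map_finsuppSum] at hz'
  simp only [map_smul, NicholsAlgebra.mk_freeMonomial] at hz'
  have hc0 : c = 0 := linearIndependent_iff.mp hind c hz'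
  rw [hc0] at hz
  simpa using hz

theorem lift_gen {ι : Type*} [Fintype ι] [DecidableEq ι] (r : ι → ι → ι → ι → k) :
    FreeAlgebra.lift k (NicholsAlgebra.gen r) = NicholsAlgebra.mk r :=
  FreeAlgebra.lift_comp_ι (NicholsAlgebra.mk r)

theorem lift_gen_surjective {ι : Type*} [Fintype ι] [DecidableEq ι] (r : ι → ι → ι → ι → k) :
    Function.Surjective (FreeAlgebra.lift k (NicholsAlgebra.gen r)) := by
  rw [lift_gen]; exact NicholsAlgebra.mk_surjective r

theorem lift_gen_eq_zero {ι : Type*} [Fintype ι] [DecidableEq ι] {r : ι → ι → ι → ι → k}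
    {S : Set (FreeAlgebra k ι)} (hS : TwoSidedIdeal.span S ≤ nicholsIdeal r) :
    ∀ s ∈ S, FreeAlgebra.lift k (NicholsAlgebra.gen r) s = 0 := fun s hs => by
  rw [lift_gen, NicholsAlgebra.mk_eq_zero_iff]
  exact hS (TwoSidedIdeal.subset_span hs)

end Presentation

/-! ### Absence of quadratic relations for `t² ≠ 1` -/

section NoQuadraticRelations

variable {k : Type*} [Field k]

theorem exists_coeff_of_mem_tensorPower_two {ι : Type*} [Fintype ι] [DecidableEq ι]
    {x : FreeAlgebra k ι} (hx : x ∈ tensorPower k ι 2) :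
    ∃ s : ι → ι → k, x = ∑ i, ∑ j, s i j • (FreeAlgebra.ι k i * FreeAlgebra.ι k j) := by
  induction hx using tensorPower_succ_induction with
  | zero => exact ⟨0, by simp⟩
  | add x y _ _ hx hy =>
    obtain ⟨s, rfl⟩ := hx
    obtain ⟨s', rfl⟩ := hy
    exact ⟨s + s', by simp [add_smul, Finset.sum_add_distrib]⟩
  | smul c x _ hx =>
    obtain ⟨s, rfl⟩ := hx
    exact ⟨c • s, by simp [mul_smul, Finset.smul_sum]⟩
  | mul i x hx _ =>
    rw [tensorPower_one] at hx
    obtain ⟨c, rfl⟩ := (Submodule.mem_span_range_iff_exists_fun k).mp hx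
    refine ⟨fun i' j => if i' = i then c j else 0, ?_⟩
    rw [Finset.mul_sum, eq_comm, Finset.sum_eq_single i (fun i' _ h => by simp [h]) (by simp)]
    simp

/-- The value of `ε ∂_m ∂_l` on `x_i x_j` is the coefficient of `x_m ⊗ x_l` in `(1 + c)(x_i ⊗ x_j)`.
Thus quadratic elements of `J(V)` lie in the kernel of `1 + c`. -/
theorem coeff_eq_of_mem_nicholsIdeal {ι : Type*} [Fintype ι] [DecidableEq ι]
    {r : ι → ι → ι → ι → k} {s : ι → ι → k}
    (hx : ∑ i, ∑ j, s i j • (FreeAlgebra.ι k i * FreeAlgebra.ι k j) ∈ nicholsIdeal r) (m l : ι) :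
    s m l + ∑ i, ∑ j, s i j * r i j m l = 0 := by
  have h := algebraMapInv_eq_zero_of_mem_nicholsIdeal
    (skewDeriv_mem_nicholsIdeal m (skewDeriv_mem_nicholsIdeal l hx))
  have hij : ∀ i j, FreeAlgebra.algebraMapInv (skewDeriv r m (skewDeriv r l
      (FreeAlgebra.ι k i * FreeAlgebra.ι k j))) =
      (if j = l then if i = m then 1 else 0 else 0) + r i j m l := by
    intro i j
    rw [skewDeriv_ι_mul, letterBraiding_ι, skewDeriv_ι, mul_ite, mul_one, mul_zero]
    simp only [map_add, map_sum, map_smul, skewDeriv_ι, apply_ite (skewDeriv r m), map_zero]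
    congr 1
    · split_ifs <;> simp
    · simp [apply_ite, FreeAlgebra.algebraMapInv]
  simp only [map_sum, map_smul, hij, smul_eq_mul, mul_add, Finset.sum_add_distrib] at h
  rw [← h]
  simp

theorem eq_zero_of_mem_nicholsIdeal_R11 {t a b p : k} (ht : t ^ 2 ≠ 1)
    {x : FreeAlgebra k (Fin 3)} (hx : x ∈ tensorPower k (Fin 3) 2)
    (hJ : x ∈ nicholsIdeal (braidingR11 t a b p)) : x = 0 := by
  obtain ⟨s, rfl⟩ := exists_coeff_of_mem_tensorPower_two hx
  have key := coeff_eq_of_mem_nicholsIdeal hJ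
  have h1 : 1 - t ^ 2 ≠ 0 := sub_ne_zero.mpr ht.symm
  have e00 := key 0 0
  have e01 := key 0 1
  have e02 := key 0 2
  have e10 := key 1 0
  have e11 := key 1 1
  have e12 := key 1 2
  have e20 := key 2 0
  have e21 := key 2 1
  have e22 := key 2 2
  simp only [Fin.sum_univ_three, braidingR11, Matrix.of_apply, Matrix.cons_val, mul_zero, add_zero,
    zero_add] at e00 e01 e02 e10 e11 e12 e20 e21 e22
  -- The system is block triangular: each pair `s i j`, `s j i` has the block with rows `(1, t)` and
  -- `(t, 1)` of determinant `1 - t²`, and each `s i i` has the factor `1 + t`. Coefficients of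
  -- higher index are eliminated first.
  have cancel : ∀ c : k, (1 - t ^ 2) * c = 0 → c = 0 := fun c h =>
    (mul_eq_zero.mp h).resolve_left h1
  have s22 : s 2 2 = 0 := cancel _ (by linear_combination (1 - t) * e22)
  have s11 : s 1 1 = 0 := cancel _ (by linear_combination (1 - t) * e11)
  have s12 : s 1 2 = 0 := cancel _ (by linear_combination e12 - t * e21)
  have s21 : s 2 1 = 0 := cancel _ (by linear_combination e21 - t * e12)
  simp only [s22, s12, s21, zero_mul, add_zero] at e02 e20 e01 e10 e00
  have s02 : s 0 2 = 0 := cancel _ (by linear_combination e02 - t * e20)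
  have s20 : s 2 0 = 0 := cancel _ (by linear_combination e20 - t * e02)
  have s01 : s 0 1 = 0 := cancel _ (by linear_combination e01 - t * e10)
  have s10 : s 1 0 = 0 := cancel _ (by linear_combination e10 - t * e01)
  simp only [s02, s20, zero_mul, add_zero] at e00
  have s00 : s 0 0 = 0 := cancel _ (by linear_combination (1 - t) * e00)
  simp [Fin.sum_univ_three, s00, s01, s02, s10, s11, s12, s20, s21, s22]

end NoQuadraticRelations

end BraidedNichols

namespace BraidedNichols

/-! ### Growth and Gelfand-Kirillov dimension -/

section GKDim

open Filter Topology

variable {k : Type*} [Field k] {A : Type*} [Ring A] [Algebra k A]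

theorem tendsto_const_div_log (c : ℝ) :
    Tendsto (fun n : ℕ => c / Real.log n) atTop (𝓝 0) :=
  (Real.tendsto_log_atTop.comp tendsto_natCast_atTop_atTop).const_div_atTop c

theorem limsup_le_of_eventually_le {u v : ℕ → ℝ} {l : ℝ} (h : ∀ᶠ n in atTop, u n ≤ v n)
    (hv : Tendsto v atTop (𝓝 l)) : limsup (fun n => (u n : EReal)) atTop ≤ l := by
  rw [← ((continuous_coe_real_ereal.tendsto l).comp hv).limsup_eq]
  exact limsup_le_limsup (h.mono fun n hn => EReal.coe_le_coe_iff.mpr hn)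

theorem le_limsup_of_eventually_le {u v : ℕ → ℝ} {l : ℝ} (h : ∀ᶠ n in atTop, v n ≤ u n)
    (hv : Tendsto v atTop (𝓝 l)) : (l : EReal) ≤ limsup (fun n => (u n : EReal)) atTop := by
  rw [← ((continuous_coe_real_ereal.tendsto l).comp hv).limsup_eq]
  exact limsup_le_limsup (h.mono fun n hn => EReal.coe_le_coe_iff.mpr hn)

/-- The assumption `1 ≤ c` covers `m = 0`, where `Real.log 0 = 0`. -/
theorem log_natCast_le_log {m : ℕ} {c : ℝ} (hc : 1 ≤ c) (h : (m : ℝ) ≤ c) :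
    Real.log m ≤ Real.log c := by
  rcases Nat.eq_zero_or_pos m with rfl | hm
  · simpa using Real.log_nonneg hc
  · exact Real.log_le_log (by exact_mod_cast hm) h

/-- A finite-dimensional algebra has Gelfand-Kirillov dimension zero. -/
theorem gkDim_eq_zero [Module.Finite k A] : gkDim k A = 0 := by
  have hlog : ∀ᶠ n : ℕ in atTop, 0 < Real.log n := by
    filter_upwards [eventually_ge_atTop 2] with n hn
    exact Real.log_pos (by exact_mod_cast hn)
  refine le_antisymm (iSup_le fun W => ?_) ?_
  · refine limsup_le_of_eventually_le (v := fun n : ℕ =>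
      Real.log (Module.finrank k A + 1 : ℝ) / Real.log n) (l := 0) ?_ (tendsto_const_div_log _)
    filter_upwards [hlog] with n hn
    refine div_le_div_of_nonneg_right ?_ hn.le
    refine log_natCast_le_log (le_add_of_nonneg_left (Nat.cast_nonneg _)) ?_
    have := Submodule.finrank_le (W.1 ^ n)
    exact_mod_cast this.trans (Nat.le_succ _)
  -- The line `k · 1` is an admissible subspace, and its logarithmic quotients are eventually
  -- nonnegative.
  · refine le_iSup_of_le ⟨1, inferInstance, (Submodule.one_le.mp le_rfl)⟩ ?_
    refine le_limsup_of_eventually_le (v := fun _ : ℕ => 0) (l := 0) ?_ tendsto_const_nhds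
    filter_upwards [hlog] with n hn
    exact div_nonneg (Real.log_natCast_nonneg _) hn.le

variable {x : Fin 3 → A}

variable (k) in
/-- The span of `1` and the generators. -/
def generatingSpace (x : Fin 3 → A) : Submodule k A :=
  Submodule.span k (insert 1 (Set.range x))

theorem one_le_generatingSpace : 1 ≤ generatingSpace k x :=
  Submodule.one_le.mpr (Submodule.subset_span (Set.mem_insert _ _))

theorem mem_generatingSpace (i : Fin 3) : x i ∈ generatingSpace k x :=
  Submodule.subset_span (Set.mem_insert_of_mem _ ⟨i, rfl⟩)

theorem generatingSpace_pow_mono {m n : ℕ} (h : m ≤ n) :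
    generatingSpace k x ^ m ≤ generatingSpace k x ^ n :=
  pow_le_pow_right' one_le_generatingSpace h

theorem exists_mem_generatingSpace_pow (hx : Function.Surjective (FreeAlgebra.lift k x)) (z : A) :
    ∃ n, z ∈ generatingSpace k x ^ n := by
  obtain ⟨y, rfl⟩ := hx z
  induction y using freeAlgebra_induction_left with
  | one => exact ⟨0, by rw [map_one, pow_zero]; exact (Submodule.one_le.mp le_rfl)⟩
  | add y z hy hz =>
    obtain ⟨m, hm⟩ := hy
    obtain ⟨n, hn⟩ := hz
    exact ⟨max m n, by
      rw [map_add]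
      exact add_mem (generatingSpace_pow_mono (le_max_left _ _) hm)
        (generatingSpace_pow_mono (le_max_right _ _) hn)⟩
  | smul s y hy =>
    obtain ⟨m, hm⟩ := hy
    exact ⟨m, by rw [map_smul]; exact Submodule.smul_mem _ _ hm⟩
  | mul i y hy =>
    obtain ⟨m, hm⟩ := hy
    refine ⟨m + 1, ?_⟩
    rw [map_mul, FreeAlgebra.lift_ι_apply, pow_succ']
    exact Submodule.mul_mem_mul (mem_generatingSpace i) hm

theorem exists_le_generatingSpace_pow (hx : Function.Surjective (FreeAlgebra.lift k x))
    (W : Submodule k A) [FiniteDimensional k W] : ∃ n, W ≤ generatingSpace k x ^ n := by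
  obtain ⟨s, rfl⟩ : W.FG := Module.Finite.iff_fg.mp inferInstance
  choose d hd using exists_mem_generatingSpace_pow (k := k) hx
  exact ⟨s.sup d, Submodule.span_le.mpr fun z hz =>
    generatingSpace_pow_mono (Finset.le_sup hz) (hd z)⟩

theorem SymmetricRelations.generatingSpace_pow_le {a b : k} (H : SymmetricRelations a b x)
    (n : ℕ) : generatingSpace k x ^ n ≤ monomialFiltration k x n := by
  induction n with
  | zero =>
    rw [pow_zero, Submodule.one_le]
    simpa using monomial_mem_filtration (k := k) (x := x) (m := 0) (i := 0) (j := 0) (l := 0) le_rfl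
  | succ n ih =>
    rw [pow_succ', Submodule.mul_le]
    intro u hu v hv
    have hv' := ih hv
    induction hu using Submodule.span_induction with
    | mem u h =>
      rcases h with rfl | ⟨i, rfl⟩
      · rw [one_mul]; exact monomialFiltration_mono (Nat.le_succ n) hv'
      · exact H.letter_mul_mem i hv'
    | zero => rw [zero_mul]; exact zero_mem _
    | add u w _ _ hu hw => rw [add_mul]; exact add_mem hu hw
    | smul s u _ hu => rw [smul_mul_assoc]; exact Submodule.smul_mem _ _ hu

theorem monomialFiltration_le_span_range (n : ℕ) :
    monomialFiltration k x n ≤ Submodule.span k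
      (Set.range fun e : Fin 3 → Fin (n + 1) => monomialOf x fun i => (e i : ℕ)) := by
  refine Submodule.span_mono ?_
  rintro _ ⟨e, he, rfl⟩
  refine ⟨fun i => ⟨e i, ?_⟩, rfl⟩
  have hi : i = 0 ∨ i = 1 ∨ i = 2 := by omega
  rcases hi with rfl | rfl | rfl <;> omega

theorem finrank_le_of_le_monomialFiltration {W : Submodule k A} {n : ℕ}
    (h : W ≤ monomialFiltration k x n) : Module.finrank k W ≤ (n + 1) ^ 3 := by
  have : FiniteDimensional k (Submodule.span k
      (Set.range fun e : Fin 3 → Fin (n + 1) => monomialOf x fun i => (e i : ℕ))) :=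
    FiniteDimensional.span_of_finite k (Set.finite_range _)
  refine (Submodule.finrank_mono (h.trans (monomialFiltration_le_span_range n))).trans ?_
  refine (finrank_range_le_card _).trans ?_
  simp

theorem monomialOf_mem_generatingSpace_pow (e : Fin 3 → ℕ) :
    monomialOf x e ∈ generatingSpace k x ^ (e 0 + e 1 + e 2) := by
  rw [monomialOf, add_assoc, pow_add, pow_add]
  exact Submodule.mul_mem_mul (Submodule.pow_mem_pow _ (mem_generatingSpace 0) _)
    (Submodule.mul_mem_mul (Submodule.pow_mem_pow _ (mem_generatingSpace 1) _)
      (Submodule.pow_mem_pow _ (mem_generatingSpace 2) _))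

theorem fg_generatingSpace_pow (n : ℕ) : FiniteDimensional k ↥(generatingSpace k x ^ n) :=
  Module.Finite.iff_fg.mpr
    (Submodule.FG.pow (Submodule.fg_span ((Set.finite_range x).insert 1)) n)

/-- Monomials with all three exponents at most `n / 3` have total degree at most `n`; this cube
suffices for cubic growth. -/
theorem le_finrank_generatingSpace_pow (hind : LinearIndependent k (monomialOf x)) (n : ℕ) :
    (n / 3 + 1) ^ 3 ≤ Module.finrank k ↥(generatingSpace k x ^ n) := by
  have := fg_generatingSpace_pow (k := k) (x := x) n
  have hli : LinearIndependent k
      (fun e : Fin 3 → Fin (n / 3 + 1) => monomialOf x fun i => (e i : ℕ)) :=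
    hind.comp (fun (e : Fin 3 → Fin (n / 3 + 1)) i => (e i : ℕ)) fun e e' h =>
      funext fun i => Fin.ext (congrFun h i)
  have hcard := finrank_span_eq_card hli
  rw [Fintype.card_fun, Fintype.card_fin, Fintype.card_fin] at hcard
  rw [← hcard]
  refine Submodule.finrank_mono (Submodule.span_le.mpr ?_)
  rintro _ ⟨e, rfl⟩
  refine generatingSpace_pow_mono ?_ (monomialOf_mem_generatingSpace_pow _)
  have h0 := (e 0).is_lt
  have h1 := (e 1).is_lt
  have h2 := (e 2).is_lt
  omega

/-- An algebra with the relations for `t = 1` in which the ordered monomials are linearly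
independent has Gelfand-Kirillov dimension three. -/
theorem SymmetricRelations.gkDim_eq_three {a b : k} (H : SymmetricRelations a b x)
    (hx : Function.Surjective (FreeAlgebra.lift k x))
    (hind : LinearIndependent k (monomialOf x)) : gkDim k A = 3 := by
  have hlog : ∀ᶠ n : ℕ in atTop, 0 < Real.log n := by
    filter_upwards [eventually_ge_atTop 2] with n hn
    exact Real.log_pos (by exact_mod_cast hn)
  have lim : ∀ c : ℝ, Tendsto (fun n : ℕ => c / Real.log n + 3) atTop (𝓝 3) := fun c => by
    simpa using (tendsto_const_div_log c).add_const 3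
  refine le_antisymm (iSup_le fun ⟨W, hW, _⟩ => ?_) ?_
  · obtain ⟨d, hd⟩ := exists_le_generatingSpace_pow hx W
    -- From `W ≤ generatingSpace k x ^ d` one gets `dim W^n ≤ (d n + 1)³ ≤ ((d + 1) n)³` for `n ≥
    -- 1`; the logarithm of the last term gives the constant.
    refine limsup_le_of_eventually_le (l := 3) ?_ (lim (3 * Real.log (d + 1)))
    filter_upwards [hlog, eventually_ge_atTop 1] with n hn hn1
    have hle : W ^ n ≤ monomialFiltration k x (d * n) := by
      refine le_trans ?_ (H.generatingSpace_pow_le (d * n))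
      rw [pow_mul]
      exact pow_le_pow_left' hd n
    have hfin : (Module.finrank k ↥(W ^ n) : ℝ) ≤ ((d + 1) * n) ^ 3 := by
      have h1 := finrank_le_of_le_monomialFiltration hle
      have h2 : (d * n + 1) ^ 3 ≤ ((d + 1) * n) ^ 3 := Nat.pow_le_pow_left (by nlinarith) 3
      exact_mod_cast h1.trans h2
    have hn1' : (1 : ℝ) ≤ n := by exact_mod_cast hn1
    have hd0 : (0 : ℝ) ≤ d := Nat.cast_nonneg d
    have hbound := log_natCast_le_log (one_le_pow₀ (by nlinarith)) hfin
    rw [Real.log_pow, Real.log_mul (by positivity) (by positivity)] at hbound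
    rw [div_add' _ _ _ hn.ne', div_le_div_iff_of_pos_right hn]
    refine hbound.trans (le_of_eq ?_)
    push_cast
    ring
  · refine le_iSup_of_le ⟨generatingSpace k x, ?_, Submodule.one_le.mp one_le_generatingSpace⟩ ?_
    · exact FiniteDimensional.span_of_finite k ((Set.finite_range x).insert 1)
    -- The constant comes from `(n / 3)³` with real division, which is below the cube of the integer
    -- quotient plus one.
    refine le_limsup_of_eventually_le (l := 3) ?_ (lim (-(3 * Real.log 3)))
    filter_upwards [hlog, eventually_ge_atTop 1] with n hn hn1
    have hn1' : (1 : ℝ) ≤ n := by exact_mod_cast hn1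
    have hfin : ((n : ℝ) / 3) ^ 3 ≤ Module.finrank k ↥(generatingSpace k x ^ n) := by
      have h1 : ((n / 3 + 1 : ℕ) : ℝ) ^ 3 ≤ Module.finrank k ↥(generatingSpace k x ^ n) := by
        exact_mod_cast le_finrank_generatingSpace_pow hind n
      refine le_trans (pow_le_pow_left₀ (by positivity) ?_ 3) h1
      rw [div_le_iff₀ (by norm_num)]
      have : n ≤ (n / 3 + 1) * 3 := by omega
      exact_mod_cast this
    have hbound := Real.log_le_log (by positivity) hfin
    rw [Real.log_pow, Real.log_div (by positivity) (by norm_num)] at hbound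
    rw [div_add' _ _ _ hn.ne', div_le_div_iff_of_pos_right hn]
    refine le_trans (le_of_eq ?_) hbound
    push_cast
    ring

end GKDim

end BraidedNichols

/-! ### The main theorem -/

theorem proposition3p1 {k : Type*} [Field k] [CharZero k] (t a b p : k) (ht : t ≠ 0) :
    -- if `t ^ 2 ≠ 1`, there are no quadratic relations
    (t ^ 2 ≠ 1 →
      ∀ x ∈ BraidedNichols.tensorPower k (Fin 3) 2,
        x ∈ BraidedNichols.nicholsIdeal (BraidedNichols.braidingR11 t a b p) → x = 0) ∧
    -- `t = -1`: presentation, basis, dimension and GK-dimension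
    (t = -1 →
      BraidedNichols.nicholsIdeal (BraidedNichols.braidingR11 t a b p) =
        TwoSidedIdeal.span (BraidedNichols.relationsMinusOne b p) ∧
      LinearIndependent k (fun e : Fin 3 → Fin 2 =>
        BraidedNichols.orderedMonomial (BraidedNichols.braidingR11 t a b p)
          (fun i => (e i : ℕ))) ∧
      Submodule.span k (Set.range fun e : Fin 3 → Fin 2 =>
        BraidedNichols.orderedMonomial (BraidedNichols.braidingR11 t a b p)
          (fun i => (e i : ℕ))) = ⊤ ∧
      Module.finrank k
        (BraidedNichols.NicholsAlgebra (BraidedNichols.braidingR11 t a b p)) = 8 ∧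
      BraidedNichols.gkDim k
        (BraidedNichols.NicholsAlgebra (BraidedNichols.braidingR11 t a b p)) = 0) ∧
    -- `t = 1`: presentation, basis and GK-dimension
    (t = 1 →
      BraidedNichols.nicholsIdeal (BraidedNichols.braidingR11 t a b p) =
        TwoSidedIdeal.span (BraidedNichols.relationsOne a b) ∧
      LinearIndependent k (fun e : Fin 3 → ℕ =>
        BraidedNichols.orderedMonomial (BraidedNichols.braidingR11 t a b p) e) ∧
      Submodule.span k (Set.range fun e : Fin 3 → ℕ =>
        BraidedNichols.orderedMonomial (BraidedNichols.braidingR11 t a b p) e) = ⊤ ∧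
      BraidedNichols.gkDim k
        (BraidedNichols.NicholsAlgebra (BraidedNichols.braidingR11 t a b p)) = 3) := by
  open BraidedNichols in
  refine ⟨fun h x hx hJ => eq_zero_of_mem_nicholsIdeal_R11 h hx hJ, ?_, ?_⟩
  · rintro rfl
    have hind : LinearIndependent k fun e : Fin 3 → Fin 2 =>
        orderedMonomial (braidingR11 (-1) a b p) fun i => (e i : ℕ) := by
      refine linearIndependent_orderedMonomial (fun (e : Fin 3 → Fin 2) i => (e i : ℕ))
        (fun e e' h => funext fun i => Fin.ext (congrFun h i)) fun e i => ?_
      have hi : e i = 0 ∨ e i = 1 := by omega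
      -- Exponents at most one only involve the factorials of `0` and `1`, which equal `1`; the
      -- vanishing number `1 + t` never enters.
      rcases hi with hi | hi <;> simp [hi, qFactorial_zero, qFactorial_one]
    have hS := (lift_relationsMinusOne _).mp (presentation_relations (relationsMinusOne b p))
    have hopf : IsHopfIdeal (braidingR11 (-1) a b p) _ := isHopfIdeal_relationsMinusOne
    -- The relations hold in the Nichols algebra as soon as their ideal is a Hopf ideal, so spanning
    -- there does not need the equality of ideals.
    have hgen := (lift_relationsMinusOne _).mp (lift_gen_eq_zero hopf.le_nicholsIdeal)
    have hspan := hgen.span_eq_top (lift_gen_surjective _)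
    simp_rw [monomialOf_gen] at hspan
    let B := Module.Basis.mk hind hspan.ge
    have : Module.Finite k (NicholsAlgebra (braidingR11 (-1) a b p)) := Module.Finite.of_basis B
    refine ⟨nicholsIdeal_eq_span _ hopf (hS.span_eq_top ?_) hind, hind, hspan, ?_, gkDim_eq_zero⟩
    · rw [lift_presentationMk]; exact presentationMk_surjective _
    · rw [Module.finrank_eq_card_basis B]; simp
  · rintro rfl
    have hind : LinearIndependent k fun e : Fin 3 → ℕ =>
        orderedMonomial (braidingR11 1 a b p) e :=
      linearIndependent_orderedMonomial id Function.injective_id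
        fun _ _ => qFactorial_one_left_ne_zero _
    have hS := (lift_relationsOne _).mp (presentation_relations (relationsOne a b))
    have hopf : IsHopfIdeal (braidingR11 1 a b p) _ := isHopfIdeal_relationsOne
    have hgen := (lift_relationsOne _).mp (lift_gen_eq_zero hopf.le_nicholsIdeal)
    have hspan := hgen.span_eq_top (lift_gen_surjective _)
    have hgk := hgen.gkDim_eq_three (lift_gen_surjective _) (by
      simpa only [funext (monomialOf_gen _)] using hind)
    rw [funext (monomialOf_gen _)] at hspan
    refine ⟨nicholsIdeal_eq_span id hopf (hS.span_eq_top ?_) hind, hind, hspan, hgk⟩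
    rw [lift_presentationMk]; exact presentationMk_surjective _
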